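/- Let $s\ge 3$ and let $\mathbb G$ be a type I filiform group of step $s$: a connected and simply connected (Hausdorff) Lie group whose Lie algebra $\mathfrak g=T_e\mathbb G$ has a stratification $\mathfrak g=\mathfrak g_1\oplus\dots\oplus\mathfrak g_s$ (that is, $\mathfrak g_{i+1}=[\mathfrak g_1,\mathfrak g_i]$ for $1\le i\le s-1$ and $[\mathfrak g,\mathfrak g_s]=0$) and a basis $X_1,\dots,X_{s+1}$ with $\mathfrak g_1=\mathrm{span}\{X_1,X_2\}$, $\mathfrak g_j=\mathrm{span}\{X_{j+1}\}$ for $2\le j\le s$, such that, up to antisymmetry, the only nonzero brackets of basis vectors are $[X_1,X_j]=X_{j+1}$ for $2\le j\le s$. Identify $\mathfrak g_1$ with $\mathbb R^2$ through $X_1,X_2$. For a control $u=(u_1,u_2)\in L^1([0,1],\mathbb R^2)$ let $\gamma_u:[0,1]\to\mathbb G$ be the absolutely continuous curve with $\gamma_u(0)=e$ and $\dot\gamma_u(t)=(dL_{\gamma_u(t)})_e\bigl(u_1(t)X_1+u_2(t)X_2\bigr)$ for a.e. $t\in[0,1]$, where $L_g$ is the left translation by $g$, and let $F(u)=\gamma_u(1)$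 be the endpoint map. The control $u$ is singular if the differential $d_uF:L^1([0,1],\mathbb R^2)\to T_{F(u)}\mathbb G$ is not surjective. The abnormal curves are the curves $\gamma_u$ with $u$ singular, and $\mathrm{Abn}_{\mathbb G}=\{\gamma_u(1)\mid u\text{ singular}\}$. Then $\gamma_u$ exists and is unique for each $u\in L^1([0,1],\mathbb R^2)$, the map $F:L^1([0,1],\mathbb R^2)\to\mathbb G$ is differentiable, and: 1. a control $u\in L^1([0,1],\mathbb R^2)$ is singular if and only if $u_1=0$ a.e. on $[0,1]$; 2. the abnormal curves are exactly the absolutely continuous curves $\gamma:[0,1]\to\mathbb G$ with $\gamma(0)=e$ that are contained in the line $\{\exp(\tau X_2)\mid\tau\in\mathbb R\}$; 3. $\mathrm{Abn}_{\mathbb G}=\{\exp(\tau X_2)\mid \tau\in\mathbb R\}$, and this set is an embedded smooth submanifold of $\mathbb G$ of codimension $s$. -/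

import Mathlib

open MeasureTheory Set
open scoped Manifold ContDiff

noncomputable section

/-- Over `ℝ` the smoothness exponent that Mathlib requires for the Lie algebra of a Lie group is
finite, so that a smooth Lie group has a Lie algebra. -/
instance instLEInftyMinSmoothnessReal : ENat.LEInfty (minSmoothness ℝ 3) :=
  ⟨by rw [minSmoothness_of_isRCLikeNormedField]; exact ENat.LEInfty.out⟩

section LieAlgebra

variable {L : Type*} [LieRing L] [LieAlgebra ℝ L]

/-- `V 1, …, V s` is a stratification of step `s` of the Lie algebra `L`:
`L = V 1 ⊕ ⋯ ⊕ V s`, `V (i + 1) = [V 1, V i]` for `1 ≤ i ≤ s - 1`, and `[L, V s] = 0`.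
Only the values `V 1, …, V s` matter. -/
structure IsStratification (s : ℕ) (V : ℕ → Submodule ℝ L) : Prop where
  isInternal : DirectSum.IsInternal fun i : Fin s => V (i + 1)
  succ_eq : ∀ i, 1 ≤ i → i < s →
    V (i + 1) = Submodule.span ℝ {z : L | ∃ x ∈ V 1, ∃ y ∈ V i, ⁅x, y⁆ = z}
  bracket_last : ∀ x : L, ∀ y ∈ V s, ⁅x, y⁆ = 0

/-- The stratified Lie algebra `L = V 1 ⊕ ⋯ ⊕ V s` is filiform of type I, and `X 0, …, X s`
(that is, `X₁, …, X_{s+1}` with the indices shifted by one) is an adapted basis: `V 1` is spanned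
by `X₁, X₂`, `V j` is spanned by `X_{j+1}` for `2 ≤ j ≤ s`, and the only nontrivial brackets of
basis vectors are `[X₁, X_j] = X_{j+1}` for `2 ≤ j ≤ s` (and those given by antisymmetry). -/
structure IsTypeIFiliform (s : ℕ) (V : ℕ → Submodule ℝ L) (X : Module.Basis (Fin (s + 1)) ℝ L) :
    Prop where
  isStratification : IsStratification s V
  layer_one : V 1 = Submodule.span ℝ {X 0, X 1}
  layer : ∀ j : Fin (s + 1), 2 ≤ (j : ℕ) → V j = Submodule.span ℝ {X j}
  bracket_succ : ∀ j : ℕ, 1 ≤ j → ∀ hj : j < s,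
    ⁅X 0, X ⟨j, Nat.lt_succ_of_lt hj⟩⁆ = X ⟨j + 1, Nat.succ_lt_succ hj⟩
  bracket_last : ⁅X 0, X (Fin.last s)⁆ = 0
  bracket_eq_zero : ∀ i j : Fin (s + 1), i ≠ 0 → j ≠ 0 → ⁅X i, X j⁆ = 0

end LieAlgebra

/-- Controls `u ∈ L¹([0,1], ℝʳ)`. After the choice of a basis of the first layer `𝔤₁`, this is
`L¹([0,1], 𝔤₁)`. -/
abbrev Control (r : ℕ) : Type :=
  Lp (EuclideanSpace ℝ (Fin r)) 1 (volume.restrict (Icc (0 : ℝ) 1))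

section LieGroup

variable {E : Type*} [NormedAddCommGroup E] [NormedSpace ℝ E]
  {G : Type*} [TopologicalSpace G] [ChartedSpace E G]

/-- `γ` is an absolutely continuous curve `[0,1] → G` in a manifold: it is continuous on `[0,1]`,
and its coordinates in each preferred chart are absolutely continuous on each subinterval `[a,b]`
of `[0,1]` which `γ` maps into the domain of the chart. Values of `γ` outside `[0,1]` do not
matter. -/
def IsACCurve (γ : ℝ → G) : Prop :=
  ContinuousOn γ (Icc 0 1) ∧
    ∀ (p : G) (a b : ℝ), 0 ≤ a → a ≤ b → b ≤ 1 →
      (∀ t ∈ Icc a b, γ t ∈ (chartAt E p).source) →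
        AbsolutelyContinuousOnInterval (fun t => chartAt E p (γ t)) a b

/-- `A` is an embedded smooth submanifold of codimension `k`: near each of its points it is the
zero set of a smooth `ℝᵏ`-valued function with surjective differential at that point. -/
def IsSubmanifoldOfCodim (A : Set G) (k : ℕ) : Prop :=
  ∀ p ∈ A, ∃ U : Set G, IsOpen U ∧ p ∈ U ∧ ∃ f : G → EuclideanSpace ℝ (Fin k),
    ContMDiffOn 𝓘(ℝ, E) 𝓘(ℝ, EuclideanSpace ℝ (Fin k)) ∞ f U ∧
    Function.Surjective (mfderiv 𝓘(ℝ, E) 𝓘(ℝ, EuclideanSpace ℝ (Fin k)) f p) ∧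
    A ∩ U = {q ∈ U | f q = 0}

variable [Group G]

open Classical in
/-- The exponential map of a Lie group: `lieExp v = c 1`, where `c` is the integral curve of the
left-invariant vector field of `v` with `c 0 = 1`. -/
def lieExp (v : GroupLieAlgebra 𝓘(ℝ, E) G) : G :=
  if h : ∃ c : ℝ → G, c 0 = 1 ∧ IsMIntegralCurve (I := 𝓘(ℝ, E)) c (mulInvariantVectorField v)
  then h.choose 1 else 1

variable {r : ℕ} (X : Fin r → GroupLieAlgebra 𝓘(ℝ, E) G)

/-- `γ` restricted to `[0,1]` is the horizontal curve `γ_u` with control `u`: it is absolutely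
continuous, it issues from the identity, and for a.e. `t ∈ [0,1]` its derivative is the image of
`u₁(t) X₁ + ⋯ + u_r(t) X_r` under the differential at the identity of the left translation by
`γ t`. -/
def IsHorizontalCurve (u : Control r) (γ : ℝ → G) : Prop :=
  IsACCurve (E := E) γ ∧ γ 0 = 1 ∧
    ∀ᵐ t ∂(volume.restrict (Icc (0 : ℝ) 1)),
      HasMFDerivAt 𝓘(ℝ, ℝ) 𝓘(ℝ, E) γ t
        ((1 : ℝ →L[ℝ] ℝ).smulRight (mulInvariantVectorField (∑ i, u t i • X i) (γ t)))

open Classical in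
/-- The endpoint map `F(u) = γ_u(1)`. -/
def endpointMap (u : Control r) : G :=
  if h : ∃ γ : ℝ → G, IsHorizontalCurve X u γ then h.choose 1 else 1

/-- `u` is a singular control: the differential at `u` of the endpoint map is not surjective. -/
def IsSingularControl (u : Control r) : Prop :=
  ¬ Function.Surjective (mfderiv 𝓘(ℝ, Control r) 𝓘(ℝ, E) (endpointMap X) u)

/-- `γ` (restricted to `[0,1]`) is an abnormal curve: the horizontal curve of a singular control. -/
def IsAbnormalCurve (γ : ℝ → G) : Prop :=
  ∃ u : Control r, IsSingularControl X u ∧ IsHorizontalCurve X u γ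

/-- The abnormal set: the set of critical values of the endpoint map. -/
def abnormalSet : Set G :=
  {g | ∃ u : Control r, IsSingularControl X u ∧ endpointMap X u = g}

end LieGroup

end

/-!
The group is the semidirect product of an abelian group by a line, and in suitable global
coordinates horizontal curves are given by explicit integrals.

Let `Z = X 0` and let `ι : ℝˢ → 𝔤` send `y` to `∑ y j • X (j + 1)`. The image of `ι` is an abelian
ideal on which `ad Z` acts as the shift, `⁅Z, ι y⁆ = ι (A y)`. The *coordinates of the second kind*
are `Φ (y, x) = exp (ι y) exp (x Z)` (`secondKind`). Since `Ad (exp (x Z)) (ι y) = ι (exp (x A) y)`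
(`lieAd_lieExp_map`, which follows from `d/dt Ad (exp (t Z)) w = Ad (exp (t Z)) ⁅Z, w⁆`, see
`hasDerivAt_lieAd`), `Φ` is a homomorphism from the semidirect product `ℝˢ ⋊ ℝ`, and its
differential carries `(exp (x A) y', a)` at `(y, x)` to the left-invariant field of `ι y' + a Z`
(`mfderiv_secondKind`). Hence `Φ` is a local diffeomorphism; it is open, so surjective, and its
kernel is discrete, so it is a covering of the simply connected group `G`, and therefore a global
diffeomorphism (`exists_contMDiff_inverse_secondKind`).

In these coordinates the horizontal curve of the control `u` has `x(t) = ∫₀ᵗ u₁` and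
`y_j(t) = ∫₀ᵗ u₂ x^j / j!`. Both directions of this equivalence need that a smooth map carries
absolutely continuous curves to absolutely continuous curves, and that these are the integrals of
their derivatives. This gives existence and uniqueness, and reduces the endpoint map to
`u ↦ (∫ u₂ x^j / j!, ∫ u₁)` (`modelEndpoint`), a polynomial in continuous linear and bilinear maps,
which is differentiable.

If `u₁ = 0`, the coordinate `y₂` of the endpoint, which is quadratic in `u₁`, is critical at `u`;
here `s ≥ 3` is used. Conversely, a functional `(c, μ)` that annihilates the image of the
differential satisfies `∫ v₂ p(x) = 0` for all `v₂`, where `p = ∑ c_j X^j / j!`. So `p` vanishes on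
the range of `x`; if `u₁ ≠ 0`, this range is infinite, so `p = 0`, and then `μ = 0` as well
(`surjective_fderiv_modelEndpoint_iff`). The controls with `u₁ = 0` have `x = 0` and
`y = (∫ u₂) e₀`, which is the line `exp (τ X 1)`; in the coordinates of the second kind it is a
coordinate axis.
-/

noncomputable section

/-! ### Left-invariant vector fields and one-parameter groups -/

section OneParameter

open Bundle Filter Topology

variable {E : Type*} [NormedAddCommGroup E] [NormedSpace ℝ E]
  {G : Type*} [TopologicalSpace G] [ChartedSpace E G] [Group G] [LieGroup 𝓘(ℝ, E) ∞ G]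

/-- Mathlib's `contMDiff_mulInvariantVectorField` gives class `C²`; on a smooth group the field is
smooth. The field is the differential of the multiplication at `(g, 1)`, applied to `(0, v)`. -/
theorem contMDiff_infty_mulInvariantVectorField (v : GroupLieAlgebra 𝓘(ℝ, E) G) :
    ContMDiff 𝓘(ℝ, E) (𝓘(ℝ, E).prod 𝓘(ℝ, E)) ∞
      (fun g : G ↦ (⟨g, mulInvariantVectorField v g⟩ : TangentBundle 𝓘(ℝ, E) G)) := by
  let fg : G → TangentBundle 𝓘(ℝ, E) G := fun g ↦ TotalSpace.mk' E g 0
  have sfg : ContMDiff 𝓘(ℝ, E) (𝓘(ℝ, E).prod 𝓘(ℝ, E)) ∞ fg := contMDiff_zeroSection _ _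
  let fv : G → TangentBundle 𝓘(ℝ, E) G := fun _ ↦ TotalSpace.mk' E 1 v
  have sfv : ContMDiff 𝓘(ℝ, E) (𝓘(ℝ, E).prod 𝓘(ℝ, E)) ∞ fv := contMDiff_const
  let F₁ : G → (TangentBundle 𝓘(ℝ, E) G × TangentBundle 𝓘(ℝ, E) G) := fun g ↦ (fg g, fv g)
  have S₁ := sfg.prodMk sfv
  let F₂ : (TangentBundle 𝓘(ℝ, E) G × TangentBundle 𝓘(ℝ, E) G) →
      TangentBundle (𝓘(ℝ, E).prod 𝓘(ℝ, E)) (G × G) :=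
    (equivTangentBundleProd 𝓘(ℝ, E) G 𝓘(ℝ, E) G).symm
  have S₂ : ContMDiff _ _ ∞ F₂ := contMDiff_equivTangentBundleProd_symm
  let F₃ : TangentBundle (𝓘(ℝ, E).prod 𝓘(ℝ, E)) (G × G) → TangentBundle 𝓘(ℝ, E) G :=
    tangentMap (𝓘(ℝ, E).prod 𝓘(ℝ, E)) 𝓘(ℝ, E) (fun p : G × G ↦ p.1 * p.2)
  have S₃ : ContMDiff _ _ ∞ F₃ :=
    ContMDiff.contMDiff_tangentMap (contMDiff_mul 𝓘(ℝ, E) ∞) (m := ∞) le_rfl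
  have S := (S₃.comp S₂).comp S₁
  convert! S with g
  · simp [F₂, F₃, fg, fv]
  · simp only [Function.comp_apply, tangentMap, F₃, F₂, fg, fv]
    rw [mfderiv_prod_eq_add_apply ((contMDiff_mul 𝓘(ℝ, E) ∞).mdifferentiableAt (by simp))]
    let L : E →L[ℝ] E := mfderiv 𝓘(ℝ, E) 𝓘(ℝ, E) (fun z : G ↦ z * 1) g
    let w : E := mulInvariantVectorField v g
    change w = L 0 + w
    rw [map_zero, zero_add]

theorem mdifferentiableAt_mul_left' {g h : G} :
    MDifferentiableAt 𝓘(ℝ, E) 𝓘(ℝ, E) (fun x : G ↦ g * x) h :=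
  (contMDiff_mul_left (I := 𝓘(ℝ, E)) (n := ∞)).mdifferentiableAt (by simp)

theorem mfderiv_mul_left_mulInvariantVectorField (g h : G) (v : GroupLieAlgebra 𝓘(ℝ, E) G) :
    mfderiv 𝓘(ℝ, E) 𝓘(ℝ, E) (fun x ↦ g * x) h (mulInvariantVectorField v h) =
      mulInvariantVectorField v (g * h) := by
  have h1 : (fun x : G ↦ g * h * x) = (fun x ↦ g * x) ∘ (fun x ↦ h * x) := by
    ext x; simp [mul_assoc]
  have h2 := mfderiv_comp_apply_of_eq (I := 𝓘(ℝ, E)) (I' := 𝓘(ℝ, E)) (I'' := 𝓘(ℝ, E))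
    (g := fun x : G ↦ g * x) (f := fun x ↦ h * x) (x := (1 : G)) (y := h)
    mdifferentiableAt_mul_left' mdifferentiableAt_mul_left' (mul_one h) v
  rw [← h1] at h2
  exact h2.symm

omit [LieGroup 𝓘(ℝ, E) ∞ G] in
theorem mulInvariantVectorField_one (v : GroupLieAlgebra 𝓘(ℝ, E) G) :
    mulInvariantVectorField v (1 : G) = v := by
  have h1 : (fun x : G ↦ 1 * x) = id := by ext x; simp
  unfold mulInvariantVectorField
  rw [h1, mfderiv_id]
  rfl

theorem mulInvariantVectorField_injective (g : G) :
    Function.Injective fun v : GroupLieAlgebra 𝓘(ℝ, E) G ↦ mulInvariantVectorField v g := by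
  intro v w h
  have h1 := fun u : GroupLieAlgebra 𝓘(ℝ, E) G ↦
    mfderiv_mul_left_mulInvariantVectorField g⁻¹ g u
  have h2 := (h1 v).symm.trans ((congrArg _ h).trans (h1 w))
  rw [inv_mul_cancel, mulInvariantVectorField_one, mulInvariantVectorField_one] at h2
  exact h2

/-- A left translate of a curve that follows a left-invariant field follows the same field. -/
theorem HasMFDerivWithinAt.mul_left_mulInvariantVectorField {c : ℝ → G} {S : Set ℝ} {t : ℝ}
    {v : GroupLieAlgebra 𝓘(ℝ, E) G} (g : G)
    (h : HasMFDerivWithinAt 𝓘(ℝ, ℝ) 𝓘(ℝ, E) c S t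
      ((1 : ℝ →L[ℝ] ℝ).smulRight (mulInvariantVectorField v (c t)))) :
    HasMFDerivWithinAt 𝓘(ℝ, ℝ) 𝓘(ℝ, E) (fun t ↦ g * c t) S t
      ((1 : ℝ →L[ℝ] ℝ).smulRight (mulInvariantVectorField v (g * c t))) := by
  have h1 := (mdifferentiableAt_mul_left' (E := E) (g := g) (h := c t)).hasMFDerivAt
    |>.comp_hasMFDerivWithinAt t h
  refine h1.congr_mfderiv ?_
  rw [← mfderiv_mul_left_mulInvariantVectorField]
  let L : E →L[ℝ] E := mfderiv 𝓘(ℝ, E) 𝓘(ℝ, E) (fun x ↦ g * x) (c t)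
  let w : E := mulInvariantVectorField v (c t)
  exact ContinuousLinearMap.ext fun a : ℝ ↦ L.map_smul a w

theorem HasMFDerivAt.mul_left_mulInvariantVectorField {c : ℝ → G} {t : ℝ}
    {v : GroupLieAlgebra 𝓘(ℝ, E) G} (g : G)
    (h : HasMFDerivAt 𝓘(ℝ, ℝ) 𝓘(ℝ, E) c t
      ((1 : ℝ →L[ℝ] ℝ).smulRight (mulInvariantVectorField v (c t)))) :
    HasMFDerivAt 𝓘(ℝ, ℝ) 𝓘(ℝ, E) (fun t ↦ g * c t) t
      ((1 : ℝ →L[ℝ] ℝ).smulRight (mulInvariantVectorField v (g * c t))) := by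
  exact hasMFDerivWithinAt_univ.1
    ((hasMFDerivWithinAt_univ.2 h).mul_left_mulInvariantVectorField g)

theorem contMDiff_one_mulInvariantVectorField (v : GroupLieAlgebra 𝓘(ℝ, E) G) :
    ContMDiff 𝓘(ℝ, E) (𝓘(ℝ, E).prod 𝓘(ℝ, E)) 1
      (fun g : G ↦ (⟨g, mulInvariantVectorField v g⟩ : TangentBundle 𝓘(ℝ, E) G)) :=
  (contMDiff_infty_mulInvariantVectorField v).of_le (by simp)

variable [CompleteSpace E] [T2Space G]

/-- Left-invariant vector fields are complete: the time of existence of the integral curve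
through `1` is, by translation, a uniform time of existence. -/
theorem exists_isMIntegralCurve_mulInvariantVectorField (v : GroupLieAlgebra 𝓘(ℝ, E) G) :
    ∃ c : ℝ → G, c 0 = 1 ∧ IsMIntegralCurve (I := 𝓘(ℝ, E)) c (mulInvariantVectorField v) := by
  have hv := contMDiff_one_mulInvariantVectorField v
  obtain ⟨γ, hγ, hγ'⟩ := exists_isMIntegralCurveAt_of_contMDiffAt_boundaryless (I := 𝓘(ℝ, E))
    0 (hv.contMDiffAt (x := (1 : G)))
  obtain ⟨ε, hε, h⟩ := isMIntegralCurveAt_iff'.1 hγ'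
  refine exists_isMIntegralCurve_of_isMIntegralCurveOn hv hε (fun g ↦ ?_) 1
  refine ⟨fun t ↦ g * γ t, by simp [hγ], fun t ht ↦ ?_⟩
  rw [show Ioo (-ε) ε = Metric.ball 0 ε by simp [Real.ball_eq_Ioo]] at ht ⊢
  exact (h t ht).mul_left_mulInvariantVectorField g

omit [CompleteSpace E] in
theorem eq_of_isMIntegralCurve {v : GroupLieAlgebra 𝓘(ℝ, E) G} {c c' : ℝ → G}
    (hc : IsMIntegralCurve (I := 𝓘(ℝ, E)) c (mulInvariantVectorField v))
    (hc' : IsMIntegralCurve (I := 𝓘(ℝ, E)) c' (mulInvariantVectorField v))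
    (h : c 0 = c' 0) : c = c' :=
  isMIntegralCurve_Ioo_eq_of_contMDiff_boundaryless (contMDiff_one_mulInvariantVectorField v)
    hc hc' h

omit [CompleteSpace E] in
theorem lieExp_eq_of_isMIntegralCurve {v : GroupLieAlgebra 𝓘(ℝ, E) G} {c : ℝ → G} (h0 : c 0 = 1)
    (hc : IsMIntegralCurve (I := 𝓘(ℝ, E)) c (mulInvariantVectorField v)) (t : ℝ) :
    lieExp (t • v) = c t := by
  have key : ∀ (w : GroupLieAlgebra 𝓘(ℝ, E) G) (d : ℝ → G), d 0 = 1 →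
      IsMIntegralCurve (I := 𝓘(ℝ, E)) d (mulInvariantVectorField w) → lieExp w = d 1 := by
    intro w d hd hd'
    have hex : ∃ c : ℝ → G, c 0 = 1 ∧
      IsMIntegralCurve (I := 𝓘(ℝ, E)) c (mulInvariantVectorField w) := ⟨d, hd, hd'⟩
    rw [lieExp, dif_pos hex,
      eq_of_isMIntegralCurve hex.choose_spec.2 hd' (hex.choose_spec.1.trans hd.symm)]
  have h1 := hc.comp_mul t
  rw [← mulInvariantVectorField_smul] at h1
  simpa using key _ _ (by simpa using h0) h1

theorem isMIntegralCurve_lieExp (v : GroupLieAlgebra 𝓘(ℝ, E) G) :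
    IsMIntegralCurve (I := 𝓘(ℝ, E)) (fun t : ℝ ↦ lieExp (t • v)) (mulInvariantVectorField v) := by
  obtain ⟨c, h0, hc⟩ := exists_isMIntegralCurve_mulInvariantVectorField v
  convert! hc using 1
  ext t
  exact lieExp_eq_of_isMIntegralCurve h0 hc t

theorem lieExp_zero : lieExp (0 : GroupLieAlgebra 𝓘(ℝ, E) G) = 1 := by
  obtain ⟨c, h0, hc⟩ :=
    exists_isMIntegralCurve_mulInvariantVectorField (0 : GroupLieAlgebra 𝓘(ℝ, E) G)
  simpa [h0] using lieExp_eq_of_isMIntegralCurve h0 hc 0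

theorem lieExp_add_smul (v : GroupLieAlgebra 𝓘(ℝ, E) G) (a b : ℝ) :
    lieExp ((a + b) • v) = lieExp (a • v) * lieExp (b • v) := by
  have h1 := (isMIntegralCurve_lieExp v).comp_add a
  have h2 : IsMIntegralCurve (I := 𝓘(ℝ, E)) (fun t : ℝ ↦ lieExp (a • v) * lieExp (t • v))
      (mulInvariantVectorField v) :=
    fun t ↦ (isMIntegralCurve_lieExp v t).mul_left_mulInvariantVectorField _
  have h3 := eq_of_isMIntegralCurve h1 h2 (by simp [lieExp_zero])
  have := congrFun h3 b
  simpa [add_comm] using this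

theorem lieExp_neg (v : GroupLieAlgebra 𝓘(ℝ, E) G) : lieExp (-v) = (lieExp v)⁻¹ := by
  have h2 := lieExp_add_smul v (-1) 1
  rw [neg_add_cancel, zero_smul, lieExp_zero, neg_one_smul, one_smul] at h2
  exact eq_inv_of_mul_eq_one_left h2.symm

theorem hasMFDerivAt_lieExp_smul_zero (v : GroupLieAlgebra 𝓘(ℝ, E) G) :
    HasMFDerivAt 𝓘(ℝ, ℝ) 𝓘(ℝ, E) (fun t : ℝ ↦ lieExp (t • v)) 0
      ((1 : ℝ →L[ℝ] ℝ).smulRight v) := by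
  refine (isMIntegralCurve_lieExp v 0).congr_mfderiv ?_
  have : ∀ g : G, g = 1 → (mulInvariantVectorField v g : E) = v := by
    rintro g rfl; exact mulInvariantVectorField_one v
  exact congrArg _ (this _ (by simp [lieExp_zero]))

omit [CompleteSpace E] in
/-- A one-parameter group is determined by its velocity at time `0`. -/
theorem eq_lieExp_smul_of_map_add {v : GroupLieAlgebra 𝓘(ℝ, E) G} {c : ℝ → G}
    (hadd : ∀ a b, c (a + b) = c a * c b)
    (hc : HasMFDerivAt 𝓘(ℝ, ℝ) 𝓘(ℝ, E) c 0 ((1 : ℝ →L[ℝ] ℝ).smulRight (v : E))) (t : ℝ) :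
    c t = lieExp (t • v) := by
  have h0 : c 0 = 1 := by simpa using hadd 0 0
  refine (lieExp_eq_of_isMIntegralCurve h0 (fun t ↦ ?_) t).symm
  have h1 : HasMFDerivAt 𝓘(ℝ, ℝ) 𝓘(ℝ, E) c 0
      ((1 : ℝ →L[ℝ] ℝ).smulRight (mulInvariantVectorField v (c 0))) := by
    refine hc.congr_mfderiv ?_
    have : ∀ g : G, g = 1 → (mulInvariantVectorField v g : E) = v := by
      rintro g rfl; exact mulInvariantVectorField_one v
    exact congrArg _ (this _ h0).symm
  have h2 := h1.mul_left_mulInvariantVectorField (c t)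
  have h3 : HasMFDerivAt 𝓘(ℝ, ℝ) 𝓘(ℝ, ℝ) (fun r : ℝ ↦ r - t) t (ContinuousLinearMap.id ℝ ℝ) :=
    ((hasFDerivAt_id (𝕜 := ℝ) t).sub_const t).hasMFDerivAt
  have h4 : HasMFDerivAt 𝓘(ℝ, ℝ) 𝓘(ℝ, E) (fun r ↦ c t * c r) (t - t)
      ((1 : ℝ →L[ℝ] ℝ).smulRight (mulInvariantVectorField v (c t) : E)) := by
    rw [sub_self]
    convert! h2 using 3
    rw [h0, mul_one]
  have h5 := HasMFDerivAt.comp (f := fun r : ℝ ↦ r - t) t h4 h3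
  have h6 : (fun r ↦ c t * c r) ∘ (fun r ↦ r - t) = c := by
    ext r
    simp [← hadd]
  rw [h6] at h5
  exact h5

end OneParameter

/-! ### Smoothness of integral curves -/

section Smooth

open Bundle Filter Topology

/-- Solutions of an autonomous `C^n` ordinary differential equation are of class `C^n`. -/
theorem ContDiffOn.of_hasDerivAt_comp {E : Type*} [NormedAddCommGroup E] [NormedSpace ℝ E]
    {f : ℝ → E} {F : E → E} {J : Set ℝ} {U : Set E} {n : ℕ} (hF : ContDiffOn ℝ n F U)
    (hJ : IsOpen J) (hfU : MapsTo f J U) (hf : ∀ t ∈ J, HasDerivAt f (F (f t)) t) :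
    ContDiffOn ℝ n f J := by
  induction n with
  | zero => exact contDiffOn_zero.2 fun t ht ↦ (hf t ht).continuousAt.continuousWithinAt
  | succ n ih =>
    have hF' : ContDiffOn ℝ n F U := hF.of_le (by exact_mod_cast n.le_succ)
    rw [Nat.cast_succ, contDiffOn_succ_iff_deriv_of_isOpen hJ]
    refine ⟨fun t ht ↦ (hf t ht).differentiableAt.differentiableWithinAt, by simp, ?_⟩
    exact (hF'.comp (ih hF') hfU).congr fun t ht ↦ (hf t ht).deriv

/-- Integral curves of smooth vector fields are smooth. -/
theorem IsMIntegralCurve.contMDiff_infty {E : Type*} [NormedAddCommGroup E] [NormedSpace ℝ E]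
    {M : Type*} [TopologicalSpace M] [ChartedSpace E M] [IsManifold 𝓘(ℝ, E) ∞ M]
    {v : (x : M) → TangentSpace 𝓘(ℝ, E) x}
    (hv : ContMDiff 𝓘(ℝ, E) (𝓘(ℝ, E).prod 𝓘(ℝ, E)) ∞
      (fun x ↦ (⟨x, v x⟩ : TangentBundle 𝓘(ℝ, E) M)))
    {c : ℝ → M} (hc : IsMIntegralCurve (I := 𝓘(ℝ, E)) c v) :
    ContMDiff 𝓘(ℝ, ℝ) 𝓘(ℝ, E) ∞ c := by
  intro t₀
  rw [contMDiffAt_infty]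
  intro n
  set φ := extChartAt 𝓘(ℝ, E) (c t₀) with hφ
  set v' : E → E := fun x ↦ tangentCoordChange 𝓘(ℝ, E) (φ.symm x) (c t₀) (φ.symm x)
    (v (φ.symm x)) with hv'
  have h1 : ContDiffAt ℝ ∞ v' (φ (c t₀)) := by
    have h := hv.contMDiffAt (x := c t₀)
    rw [contMDiffAt_iff] at h
    exact (h.2.contDiffAt (by simp)).snd
  obtain ⟨U, hU, hU'⟩ : ∃ U ∈ 𝓝 (φ (c t₀)), ContDiffOn ℝ n v' U :=
    ContDiffAt.contDiffOn (h1.of_le (by exact_mod_cast le_top)) le_rfl (by simp)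
  have h2 : ∀ᶠ t in 𝓝 t₀, HasDerivAt (φ ∘ c) (v' ((φ ∘ c) t)) t ∧ (φ ∘ c) t ∈ U := by
    refine Eventually.and ?_ ?_
    · filter_upwards [(hc.isMIntegralCurveAt t₀).eventually_hasDerivAt,
        hc.continuous.continuousAt.preimage_mem_nhds
          (extChartAt_source_mem_nhds (I := 𝓘(ℝ, E)) (c t₀))] with t ht ht'
      refine ht.congr_deriv ?_
      simp only [hv', Function.comp_apply]
      rw [φ.left_inv ht']
    · exact ((continuousAt_extChartAt (I := 𝓘(ℝ, E)) (c t₀)).comp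
        hc.continuous.continuousAt).preimage_mem_nhds hU
  obtain ⟨J, hJ, hJo, hJt⟩ := eventually_nhds_iff.1 h2
  have h3 : ContDiffOn ℝ n (φ ∘ c) J :=
    hU'.of_hasDerivAt_comp hJo (fun t ht ↦ (hJ t ht).2) (fun t ht ↦ (hJ t ht).1)
  rw [contMDiffAt_iff]
  refine ⟨hc.continuous.continuousAt, ?_⟩
  simpa using! (h3.contDiffAt (hJo.mem_nhds hJt)).contDiffWithinAt

end Smooth

/-! ### The Lie bracket in the chart at the identity -/

section Bracket

open Bundle Filter Topology VectorField

variable {E : Type*} [NormedAddCommGroup E] [NormedSpace ℝ E]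
  {G : Type*} [TopologicalSpace G] [ChartedSpace E G] [Group G] [LieGroup 𝓘(ℝ, E) ∞ G]

variable (G) in
/-- The expression of the left-invariant vector field of `v` in the chart at the identity. -/
def chartField (v : GroupLieAlgebra 𝓘(ℝ, E) G) : E → E :=
  mpullbackWithin 𝓘(ℝ, E) 𝓘(ℝ, E) (extChartAt 𝓘(ℝ, E) (1 : G)).symm (mulInvariantVectorField v)
    (range 𝓘(ℝ, E))

theorem chartField_extChartAt (v : GroupLieAlgebra 𝓘(ℝ, E) G) {g : G}
    (hg : g ∈ (extChartAt 𝓘(ℝ, E) (1 : G)).source) :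
    chartField G v (extChartAt 𝓘(ℝ, E) (1 : G) g) =
      (mfderiv 𝓘(ℝ, E) 𝓘(ℝ, E) (extChartAt 𝓘(ℝ, E) (1 : G)) g : E →L[ℝ] E)
        (mulInvariantVectorField v g : E) := by
  set φ := extChartAt 𝓘(ℝ, E) (1 : G) with hφ
  let A : E →L[ℝ] E := mfderivWithin 𝓘(ℝ, E) 𝓘(ℝ, E) φ.symm (range 𝓘(ℝ, E)) (φ g)
  let L : E →L[ℝ] E := mfderiv 𝓘(ℝ, E) 𝓘(ℝ, E) φ g
  have hA : A.inverse = L :=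
    ContinuousLinearMap.inverse_eq (mfderivWithin_extChartAt_symm_comp_mfderiv_extChartAt' hg)
      (mfderiv_extChartAt_comp_mfderivWithin_extChartAt_symm' hg)
  have key : ∀ x : G, x = g →
      A.inverse (mulInvariantVectorField v x : E) = L (mulInvariantVectorField v g : E) := by
    rintro _ rfl
    rw [hA]
  exact key _ (φ.left_inv hg)

theorem chartField_extChartAt_one (v : GroupLieAlgebra 𝓘(ℝ, E) G) :
    chartField G v (extChartAt 𝓘(ℝ, E) (1 : G) 1) = v := by
  rw [chartField_extChartAt v (mem_extChartAt_source _)]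
  refine Eq.trans ?_ (mulInvariantVectorField_one v)
  exact congrArg (fun L : E →L[ℝ] E ↦ L (mulInvariantVectorField v (1 : G) : E))
    mfderiv_extChartAt_self

theorem differentiableAt_chartField [CompleteSpace E] (v : GroupLieAlgebra 𝓘(ℝ, E) G) :
    DifferentiableAt ℝ (chartField G v) (extChartAt 𝓘(ℝ, E) (1 : G) 1) := by
  have h1 := (contMDiff_one_mulInvariantVectorField v).mdifferentiable one_ne_zero (1 : G)
  have h2 := (mdifferentiableWithinAt_univ.2
    h1).differentiableWithinAt_mpullbackWithin_vectorField
  refine DifferentiableWithinAt.differentiableAt h2 ?_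
  simp

/-- The bracket of `𝔤` is by definition that of the left-invariant fields at the identity, and the
differential of the chart at its base point is the identity, so no correction term appears. -/
theorem bracket_eq_fderiv_chartField (v w : GroupLieAlgebra 𝓘(ℝ, E) G) :
    ((⁅v, w⁆ : GroupLieAlgebra 𝓘(ℝ, E) G) : E) =
      fderiv ℝ (chartField G w) (extChartAt 𝓘(ℝ, E) (1 : G) 1) (v : E) -
        fderiv ℝ (chartField G v) (extChartAt 𝓘(ℝ, E) (1 : G) 1) (w : E) := by
  rw [GroupLieAlgebra.bracket_def, ← mlieBracketWithin_univ, mlieBracketWithin_apply]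
  set φ := extChartAt 𝓘(ℝ, E) (1 : G) with hφ
  have h1 : (mfderiv 𝓘(ℝ, E) 𝓘(ℝ, E) φ 1 : E →L[ℝ] E) = ContinuousLinearMap.id ℝ E :=
    mfderiv_extChartAt_self
  have h2 : (φ.symm ⁻¹' univ ∩ range 𝓘(ℝ, E) : Set E) = univ := by simp
  have h3 : lieBracketWithin ℝ (E := E) (chartField G v) (chartField G w)
      (φ.symm ⁻¹' univ ∩ range 𝓘(ℝ, E)) (φ 1) =
      fderiv ℝ (chartField G w) (φ 1) (v : E) - fderiv ℝ (chartField G v) (φ 1) (w : E) := by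
    have hv : chartField G v (φ 1) = v := chartField_extChartAt_one v
    have hw : chartField G w (φ 1) = w := chartField_extChartAt_one w
    rw [h2, lieBracketWithin_univ, lieBracket_eq]
    exact congrArg₂ (· - ·) (congrArg _ hv) (congrArg _ hw)
  exact DFunLike.congr ((congrArg ContinuousLinearMap.inverse h1).trans
    ContinuousLinearMap.inverse_id) h3

theorem HasMFDerivAt.hasDerivAt_extChartAt_comp {κ : ℝ → G} {t : ℝ} {e : E}
    (h : HasMFDerivAt 𝓘(ℝ, ℝ) 𝓘(ℝ, E) κ t ((1 : ℝ →L[ℝ] ℝ).smulRight (e : E)))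
    (ht : κ t ∈ (extChartAt 𝓘(ℝ, E) (1 : G)).source) :
    HasDerivAt (fun r ↦ extChartAt 𝓘(ℝ, E) (1 : G) (κ r))
      ((mfderiv 𝓘(ℝ, E) 𝓘(ℝ, E) (extChartAt 𝓘(ℝ, E) (1 : G)) (κ t) : E →L[ℝ] E) e) t := by
  have h1 := (mdifferentiableAt_extChartAt (I := 𝓘(ℝ, E)) (by simpa using ht)).hasMFDerivAt.comp t h
  let L : E →L[ℝ] E := mfderiv 𝓘(ℝ, E) 𝓘(ℝ, E) (extChartAt 𝓘(ℝ, E) (1 : G)) (κ t)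
  have h2 : HasFDerivAt (fun r ↦ extChartAt 𝓘(ℝ, E) (1 : G) (κ r))
    (L.comp ((1 : ℝ →L[ℝ] ℝ).smulRight e)) t := hasMFDerivAt_iff_hasFDerivAt.1 h1
  have h3 : HasDerivAt (fun r ↦ extChartAt 𝓘(ℝ, E) (1 : G) (κ r)) (L e) t := by
    simpa using h2.hasDerivAt
  exact h3

theorem HasMFDerivAt.hasDerivAt_extChartAt_comp_of_eq_one {κ : ℝ → G} {t : ℝ} {e : E}
    (h : HasMFDerivAt 𝓘(ℝ, ℝ) 𝓘(ℝ, E) κ t ((1 : ℝ →L[ℝ] ℝ).smulRight (e : E)))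
    (ht : κ t = 1) :
    HasDerivAt (fun r ↦ extChartAt 𝓘(ℝ, E) (1 : G) (κ r)) e t := by
  refine (h.hasDerivAt_extChartAt_comp (by rw [ht]; exact mem_extChartAt_source _)).congr_deriv ?_
  have key : ∀ x : G, x = 1 →
      (mfderiv 𝓘(ℝ, E) 𝓘(ℝ, E) (extChartAt 𝓘(ℝ, E) (1 : G)) x : E →L[ℝ] E) e = e := by
    rintro _ rfl
    exact congrArg (fun L : E →L[ℝ] E ↦ L e) mfderiv_extChartAt_self
  exact key _ ht

theorem HasMFDerivAt.hasDerivAt_extChartAt_comp_chartField {κ : ℝ → G} {t : ℝ}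
    {v : GroupLieAlgebra 𝓘(ℝ, E) G}
    (h : HasMFDerivAt 𝓘(ℝ, ℝ) 𝓘(ℝ, E) κ t
      ((1 : ℝ →L[ℝ] ℝ).smulRight (mulInvariantVectorField v (κ t))))
    (ht : κ t ∈ (extChartAt 𝓘(ℝ, E) (1 : G)).source) :
    HasDerivAt (fun r ↦ extChartAt 𝓘(ℝ, E) (1 : G) (κ r))
      (chartField G v (extChartAt 𝓘(ℝ, E) (1 : G) (κ t))) t :=
  (HasMFDerivAt.hasDerivAt_extChartAt_comp h ht).congr_deriv (chartField_extChartAt v ht).symm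

end Bracket

/-! ### The adjoint action -/

section Adjoint

open Bundle Filter Topology

variable {E : Type*} [NormedAddCommGroup E] [NormedSpace ℝ E]
  {G : Type*} [TopologicalSpace G] [ChartedSpace E G] [Group G] [LieGroup 𝓘(ℝ, E) ∞ G]

/-- The adjoint action of `g`: the differential at the identity of `x ↦ g * x * g⁻¹`. -/
def lieAd (g : G) : GroupLieAlgebra 𝓘(ℝ, E) G →L[ℝ] GroupLieAlgebra 𝓘(ℝ, E) G :=
  (mfderiv 𝓘(ℝ, E) 𝓘(ℝ, E) (fun x : G ↦ g * x * g⁻¹) 1 : E →L[ℝ] E)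

variable [CompleteSpace E] [T2Space G]

theorem contMDiff_lieExp_smul (v : GroupLieAlgebra 𝓘(ℝ, E) G) :
    ContMDiff 𝓘(ℝ, ℝ) 𝓘(ℝ, E) ∞ (fun t : ℝ ↦ lieExp (t • v)) :=
  (isMIntegralCurve_lieExp v).contMDiff_infty (contMDiff_infty_mulInvariantVectorField v)

omit [CompleteSpace E] [T2Space G] in
theorem mdifferentiable_conj (g : G) :
    MDifferentiable 𝓘(ℝ, E) 𝓘(ℝ, E) (fun x : G ↦ g * x * g⁻¹) :=
  ((contMDiff_mul_left (I := 𝓘(ℝ, E)) (n := ∞) (a := g)).mul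
    (contMDiff_const (c := g⁻¹))).mdifferentiable (by simp)

theorem hasMFDerivAt_conj_lieExp (g : G) (v : GroupLieAlgebra 𝓘(ℝ, E) G) :
    HasMFDerivAt 𝓘(ℝ, ℝ) 𝓘(ℝ, E) (fun t : ℝ ↦ g * lieExp (t • v) * g⁻¹) 0
      ((1 : ℝ →L[ℝ] ℝ).smulRight (lieAd g v : E)) := by
  have h1 := (mdifferentiable_conj (E := E) g (lieExp ((0 : ℝ) • v))).hasMFDerivAt
  have h2 := HasMFDerivAt.comp (f := fun t : ℝ ↦ lieExp (t • v)) 0 h1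
    (hasMFDerivAt_lieExp_smul_zero v)
  have h3 : ∀ x : G, x = 1 → ((mfderiv 𝓘(ℝ, E) 𝓘(ℝ, E) (fun x : G ↦ g * x * g⁻¹) x :
      E →L[ℝ] E).comp ((1 : ℝ →L[ℝ] ℝ).smulRight (v : E))) =
      (1 : ℝ →L[ℝ] ℝ).smulRight (lieAd g v : E) := by
    rintro x rfl
    exact ContinuousLinearMap.ext fun a : ℝ ↦ (lieAd g : E →L[ℝ] E).map_smul a v
  exact h2.congr_mfderiv (h3 _ (by simp [lieExp_zero]))

/-- Conjugation by `g` carries the one-parameter group of `v` to that of `Ad g v`. -/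
theorem conj_lieExp (g : G) (v : GroupLieAlgebra 𝓘(ℝ, E) G) (t : ℝ) :
    g * lieExp (t • v) * g⁻¹ = lieExp (t • lieAd g v) := by
  refine eq_lieExp_smul_of_map_add (c := fun t ↦ g * lieExp (t • v) * g⁻¹) (fun a b ↦ ?_)
    (hasMFDerivAt_conj_lieExp g v) t
  simp [lieExp_add_smul, mul_assoc]

theorem eq_of_forall_lieExp_smul_eq {v w : GroupLieAlgebra 𝓘(ℝ, E) G}
    (h : ∀ t : ℝ, lieExp (t • v) = lieExp (t • w)) : v = w := by
  have h1 := hasMFDerivAt_lieExp_smul_zero v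
  have h2 := hasMFDerivAt_lieExp_smul_zero w
  have h3 : (fun t : ℝ ↦ lieExp (t • v)) = fun t ↦ lieExp (t • w) := funext h
  rw [h3] at h1
  have h4 := congrArg (fun L : ℝ →L[ℝ] E ↦ L 1) (hasMFDerivAt_unique h1 h2)
  exact (one_smul ℝ (v : E)).symm.trans (h4.trans (one_smul ℝ (w : E)))

theorem lieAd_mul (g h : G) (v : GroupLieAlgebra 𝓘(ℝ, E) G) :
    lieAd (g * h) v = lieAd g (lieAd h v) := by
  refine eq_of_forall_lieExp_smul_eq fun t ↦ ?_
  simp [← conj_lieExp, mul_assoc]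

theorem lieAd_one (v : GroupLieAlgebra 𝓘(ℝ, E) G) : lieAd (1 : G) v = v := by
  refine eq_of_forall_lieExp_smul_eq fun t ↦ ?_
  simp [← conj_lieExp]

/-- The differential of `Ad` at the identity is `ad`. With `F (r, t, τ)` the chart expression of
`exp (t v) exp (τ w) exp (r v)`, the vector `Ad (exp (t v)) w` is the derivative of `F` in the
direction `τ` at `(-t, t, 0)`. Its derivative in `t` is therefore the difference of the mixed second
derivatives in `(t, τ)` and in `(r, τ)`; these are derivatives of the chart expressions of the
left-invariant fields of `w` and of `v`, and their difference is the bracket. -/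
theorem hasDerivAt_lieAd_zero (v w : GroupLieAlgebra 𝓘(ℝ, E) G) :
    HasDerivAt (F := E) (fun t : ℝ ↦ (lieAd (lieExp (t • v) : G) w : E))
      ((⁅v, w⁆ : GroupLieAlgebra 𝓘(ℝ, E) G) : E) 0 := by
  set φ := extChartAt 𝓘(ℝ, E) (1 : G) with hφ
  -- `F (r, t, τ) = exp (t v) exp (τ w) exp (r v)`, read in the chart at the identity
  let F : ℝ × ℝ × ℝ → E := fun p ↦
    φ (lieExp (p.2.1 • v) * lieExp (p.2.2 • w) * lieExp (p.1 • v))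
  have hF : ContDiffAt ℝ 2 F 0 := by
    have h1 : ContMDiff 𝓘(ℝ, ℝ × ℝ × ℝ) 𝓘(ℝ, E) ∞ fun p : ℝ × ℝ × ℝ ↦
        lieExp (p.2.1 • v) * lieExp (p.2.2 • w) * lieExp (p.1 • v) := by
      have e1 : ContMDiff 𝓘(ℝ, ℝ × ℝ × ℝ) 𝓘(ℝ, ℝ) ∞ fun p : ℝ × ℝ × ℝ ↦ p.1 :=
        contDiff_fst.contMDiff
      have e2 : ContMDiff 𝓘(ℝ, ℝ × ℝ × ℝ) 𝓘(ℝ, ℝ) ∞ fun p : ℝ × ℝ × ℝ ↦ p.2.1 :=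
        (contDiff_fst.comp contDiff_snd).contMDiff
      have e3 : ContMDiff 𝓘(ℝ, ℝ × ℝ × ℝ) 𝓘(ℝ, ℝ) ∞ fun p : ℝ × ℝ × ℝ ↦ p.2.2 :=
        (contDiff_snd.comp contDiff_snd).contMDiff
      exact (((contMDiff_lieExp_smul v).comp e2).mul ((contMDiff_lieExp_smul w).comp e3)).mul
        ((contMDiff_lieExp_smul v).comp e1)
    have h2 : ContMDiffAt 𝓘(ℝ, ℝ × ℝ × ℝ) 𝓘(ℝ, E) ∞ F 0 :=
      ContMDiffAt.comp_of_eq (y := (1 : G)) (contMDiffAt_extChartAt (I := 𝓘(ℝ, E)) (n := ∞))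
        h1.contMDiffAt (by simp [lieExp_zero])
    exact h2.contDiffAt.of_le ENat.LEInfty.out
  have hF1 : ∀ᶠ p in 𝓝 (0 : ℝ × ℝ × ℝ), DifferentiableAt ℝ F p :=
    (hF.eventually (by simp)).mono fun p hp ↦ hp.differentiableAt (by simp)
  have hF2 : HasFDerivAt (fderiv ℝ F) (fderiv ℝ (fderiv ℝ F) 0) 0 :=
    ((hF.fderiv_right (m := 1) (by norm_num)).differentiableAt one_ne_zero).hasFDerivAt
  set D := fderiv ℝ (fderiv ℝ F) 0 with hD
  have hsymm : ∀ a b, D a b = D b a := (hF.isSymmSndFDerivAt (by simp)).eq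
  let e1 : ℝ × ℝ × ℝ := (1, 0, 0)
  let e2 : ℝ × ℝ × ℝ := (0, 1, 0)
  let e3 : ℝ × ℝ × ℝ := (0, 0, 1)
  -- the velocity of `F` along a line
  have hline : ∀ p e : ℝ × ℝ × ℝ, DifferentiableAt ℝ F p →
      HasDerivAt (fun r : ℝ ↦ F (p + r • e)) (fderiv ℝ F p e) 0 := fun p e hp ↦ by
    have := hp.hasFDerivAt.comp_hasDerivAt_of_eq (0 : ℝ)
      (((hasDerivAt_id (0 : ℝ)).smul_const e).const_add p) (by simp)
    simpa using! this
  have hline2 : ∀ e e' : ℝ × ℝ × ℝ,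
      HasDerivAt (fun r : ℝ ↦ fderiv ℝ F (r • e) e') (D e e') 0 := fun e e' ↦ by
    have := hF2.comp_hasDerivAt_of_eq (0 : ℝ)
      ((hasDerivAt_id (0 : ℝ)).smul_const e) (by simp)
    have h2 := this.clm_apply (hasDerivAt_const (0 : ℝ) e')
    simpa using! h2
  have hev : ∀ e : ℝ × ℝ × ℝ, ∀ᶠ r : ℝ in 𝓝 0, DifferentiableAt ℝ F (r • e) := fun e ↦ by
    have : Tendsto (fun r : ℝ ↦ r • e) (𝓝 0) (𝓝 0) := by
      have := (continuous_id.smul (continuous_const (y := e))).tendsto (0 : ℝ)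
      simpa using! this
    exact this.eventually hF1
  have hsrc : ∀ u : GroupLieAlgebra 𝓘(ℝ, E) G,
      ∀ᶠ r : ℝ in 𝓝 0, lieExp (r • u) ∈ φ.source := fun u ↦ by
    refine (contMDiff_lieExp_smul u).continuous.continuousAt.preimage_mem_nhds ?_
    rw [zero_smul, lieExp_zero]
    exact extChartAt_source_mem_nhds (I := 𝓘(ℝ, E)) (1 : G)
  have hvel : ∀ u : GroupLieAlgebra 𝓘(ℝ, E) G,
      HasDerivAt (fun r : ℝ ↦ φ (lieExp (r • u))) (u : E) 0 := fun u ↦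
    (hasMFDerivAt_lieExp_smul_zero u).hasDerivAt_extChartAt_comp_of_eq_one (by simp [lieExp_zero])
  have htrans : ∀ (u : GroupLieAlgebra 𝓘(ℝ, E) G) (g : G), g ∈ φ.source →
      HasDerivAt (fun r : ℝ ↦ φ (g * lieExp (r • u))) (chartField G u (φ g)) 0 := fun u g hg ↦ by
    have h1 := (isMIntegralCurve_lieExp u 0).mul_left_mulInvariantVectorField g
    have h2 := h1.hasDerivAt_extChartAt_comp_chartField
      (by rwa [zero_smul, lieExp_zero, mul_one])
    rwa [zero_smul, lieExp_zero, mul_one] at h2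
  have hfield : ∀ u u' : GroupLieAlgebra 𝓘(ℝ, E) G,
      HasDerivAt (fun r : ℝ ↦ chartField G u (φ (lieExp (r • u'))))
        (fderiv ℝ (chartField G u) (φ 1) (u' : E)) 0 := fun u u' ↦
    (differentiableAt_chartField u).hasFDerivAt.comp_hasDerivAt_of_eq 0 (hvel u')
      (by simp [lieExp_zero, hφ])
  -- for fixed `t`, the curve `τ ↦ exp (t v) exp (τ w)` follows the field of `w`
  have h23 : D e2 e3 = fderiv ℝ (chartField G w) (φ 1) (v : E) := by
    refine (hline2 e2 e3).unique ((hfield w v).congr_of_eventuallyEq ?_)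
    filter_upwards [hev e2, hsrc v] with t ht ht'
    refine (hline _ e3 ht).unique ((htrans w _ ht').congr_of_eventuallyEq (.of_forall fun r ↦ ?_))
    simp [F, e2, e3, lieExp_zero]
  -- for fixed `τ`, the curve `r ↦ exp (τ w) exp (r v)` follows the field of `v`
  have h31 : D e3 e1 = fderiv ℝ (chartField G v) (φ 1) (w : E) := by
    refine (hline2 e3 e1).unique ((hfield v w).congr_of_eventuallyEq ?_)
    filter_upwards [hev e3, hsrc w] with t ht ht'
    refine (hline _ e1 ht).unique ((htrans v _ ht').congr_of_eventuallyEq (.of_forall fun r ↦ ?_))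
    simp [F, e1, e3, lieExp_zero]
  -- along the direction `e2 - e1`, the derivative of `F` in the direction `e3` is the velocity of
  -- `τ ↦ exp (t v) exp (τ w) exp (-t v)`
  have hmain : HasDerivAt (fun t : ℝ ↦ fderiv ℝ F (t • (e2 - e1)) e3) (D (e2 - e1) e3) 0 :=
    hline2 _ _
  rw [bracket_eq_fderiv_chartField, ← hφ, ← h23, ← h31, hsymm e3 e1,
    ← sub_apply, ← map_sub]
  refine hmain.congr_of_eventuallyEq ?_
  filter_upwards [hev (e2 - e1)] with t ht
  have h1 := (hasMFDerivAt_conj_lieExp (lieExp (t • v)) w).hasDerivAt_extChartAt_comp_of_eq_one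
    (by simp [lieExp_zero])
  refine h1.unique ((hline _ e3 ht).congr_of_eventuallyEq (.of_forall fun r ↦ ?_))
  simp [F, e1, e2, e3, lieExp_neg, hφ]

theorem hasDerivAt_lieAd (v w : GroupLieAlgebra 𝓘(ℝ, E) G) (t : ℝ) :
    HasDerivAt (F := E) (fun t : ℝ ↦ (lieAd (lieExp (t • v) : G) w : E))
      (lieAd (lieExp (t • v) : G) (⁅v, w⁆ : GroupLieAlgebra 𝓘(ℝ, E) G) : E) t := by
  let L : E →L[ℝ] E := lieAd (lieExp (t • v) : G)
  have h0 := hasDerivAt_lieAd_zero v w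
  rw [← sub_self t] at h0
  have h1 : HasDerivAt (fun r : ℝ ↦ (lieAd (lieExp ((r - t) • v) : G) w : E))
      ((⁅v, w⁆ : GroupLieAlgebra 𝓘(ℝ, E) G) : E) t :=
    HasDerivAt.comp_sub_const t t h0
  have h2 := L.hasFDerivAt.comp_hasDerivAt t h1
  refine h2.congr_of_eventuallyEq (.of_forall fun r ↦ ?_)
  change _ = lieAd _ (lieAd _ _)
  rw [← lieAd_mul, ← lieExp_add_smul]
  simp

end Adjoint

/-! ### Exponentials of commuting elements -/

section Commuting

variable {E : Type*} [NormedAddCommGroup E] [NormedSpace ℝ E]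
  {G : Type*} [TopologicalSpace G] [ChartedSpace E G] [Group G] [LieGroup 𝓘(ℝ, E) ∞ G]

theorem ContMDiff.hasMFDerivAt_comp_line {D : Type*} [NormedAddCommGroup D] [NormedSpace ℝ D]
    {M : Type*} [TopologicalSpace M] [ChartedSpace E M] {Φ : D → M}
    (hΦ : ContMDiff 𝓘(ℝ, D) 𝓘(ℝ, E) ∞ Φ) (p d : D) :
    HasMFDerivAt 𝓘(ℝ, ℝ) 𝓘(ℝ, E) (fun t : ℝ ↦ Φ (p + t • d)) 0
      ((1 : ℝ →L[ℝ] ℝ).smulRight ((mfderiv 𝓘(ℝ, D) 𝓘(ℝ, E) Φ p : D →L[ℝ] E) d)) := by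
  have h1 : HasFDerivAt (fun t : ℝ ↦ p + t • d) ((1 : ℝ →L[ℝ] ℝ).smulRight d) 0 := by
    have := ((hasDerivAt_id (0 : ℝ)).smul_const d).const_add p
    simpa using! this.hasFDerivAt
  have h2 := (hΦ.mdifferentiable (by simp) (p + (0 : ℝ) • d)).hasMFDerivAt
  have h3 := HasMFDerivAt.comp (f := fun t : ℝ ↦ p + t • d) 0 h2 h1.hasMFDerivAt
  refine h3.congr_mfderiv ?_
  have key : ∀ q, q = p → ((mfderiv 𝓘(ℝ, D) 𝓘(ℝ, E) Φ q : D →L[ℝ] E).comp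
      ((1 : ℝ →L[ℝ] ℝ).smulRight d)) =
      (1 : ℝ →L[ℝ] ℝ).smulRight ((mfderiv 𝓘(ℝ, D) 𝓘(ℝ, E) Φ p : D →L[ℝ] E) d) := by
    rintro _ rfl
    exact ContinuousLinearMap.ext fun a : ℝ ↦ ContinuousLinearMap.map_smul _ a d
  exact key _ (by simp)

theorem HasMFDerivAt.eq_of_smulRight {M : Type*} [TopologicalSpace M] [ChartedSpace E M]
    {c : ℝ → M} {t : ℝ} {e e' : E}
    (h : HasMFDerivAt 𝓘(ℝ, ℝ) 𝓘(ℝ, E) c t ((1 : ℝ →L[ℝ] ℝ).smulRight (e : E)))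
    (h' : HasMFDerivAt 𝓘(ℝ, ℝ) 𝓘(ℝ, E) c t ((1 : ℝ →L[ℝ] ℝ).smulRight (e' : E))) : e = e' := by
  have h4 := congrArg (fun L : ℝ →L[ℝ] E ↦ L 1) (hasMFDerivAt_unique h h')
  exact (one_smul ℝ e).symm.trans (h4.trans (one_smul ℝ e'))

/-- The equality of velocities is stated in the model space, because the tangent spaces at different
base points are different types. -/
theorem HasMFDerivAt.congr_velocity {M : Type*} [TopologicalSpace M] [ChartedSpace E M]
    {c c' : ℝ → M} {t : ℝ} {e e' : E}
    (h : HasMFDerivAt 𝓘(ℝ, ℝ) 𝓘(ℝ, E) c t ((1 : ℝ →L[ℝ] ℝ).smulRight (e : E)))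
    (hc : ∀ r, c' r = c r) (he : e = e') :
    HasMFDerivAt 𝓘(ℝ, ℝ) 𝓘(ℝ, E) c' t ((1 : ℝ →L[ℝ] ℝ).smulRight (e' : E)) := by
  obtain rfl : c' = c := funext hc
  subst he
  exact h

variable [CompleteSpace E] [T2Space G]

theorem lieAd_lieExp_of_bracket_eq_zero {v w : GroupLieAlgebra 𝓘(ℝ, E) G} (h : ⁅v, w⁆ = 0)
    (t : ℝ) : lieAd (lieExp (t • v) : G) w = w := by
  have h1 : ∀ r : ℝ, HasDerivAt (F := E) (fun t : ℝ ↦ (lieAd (lieExp (t • v) : G) w : E)) 0 r := by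
    intro r
    have := hasDerivAt_lieAd v w r
    rw [h] at this
    exact this.congr_deriv (map_zero (lieAd (lieExp (r • v) : G)))
  have h2 := is_const_of_deriv_eq_zero (fun r ↦ (h1 r).differentiableAt) (fun r ↦ (h1 r).deriv) t 0
  refine h2.trans ?_
  rw [zero_smul, lieExp_zero]
  exact lieAd_one w

theorem lieExp_mul_comm_of_bracket_eq_zero {v w : GroupLieAlgebra 𝓘(ℝ, E) G} (h : ⁅v, w⁆ = 0) :
    lieExp v * lieExp w = lieExp w * lieExp v := by
  have h1 := conj_lieExp (lieExp ((1 : ℝ) • v)) w 1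
  rw [lieAd_lieExp_of_bracket_eq_zero h, one_smul, one_smul, mul_inv_eq_iff_eq_mul] at h1
  exact h1

/-- For commuting `v` and `w`, `t ↦ exp (t v) exp (t w)` is a one-parameter group with velocity `v +
w`. -/
theorem lieExp_add_of_bracket_eq_zero {v w : GroupLieAlgebra 𝓘(ℝ, E) G} (h : ⁅v, w⁆ = 0) :
    lieExp (v + w) = lieExp v * lieExp w := by
  have hcomm : ∀ a b : ℝ, lieExp (a • v) * lieExp (b • w) = lieExp (b • w) * lieExp (a • v) :=
    fun a b ↦ lieExp_mul_comm_of_bracket_eq_zero (by rw [smul_lie, lie_smul, h]; simp)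
  let Φ : ℝ × ℝ → G := fun p ↦ lieExp (p.1 • v) * lieExp (p.2 • w)
  have hΦ : ContMDiff 𝓘(ℝ, ℝ × ℝ) 𝓘(ℝ, E) ∞ Φ :=
    ((contMDiff_lieExp_smul v).comp contDiff_fst.contMDiff).mul
      ((contMDiff_lieExp_smul w).comp contDiff_snd.contMDiff)
  let L : ℝ × ℝ →L[ℝ] E := mfderiv 𝓘(ℝ, ℝ × ℝ) 𝓘(ℝ, E) Φ 0
  have hv : L (1, 0) = v := by
    refine (hΦ.hasMFDerivAt_comp_line 0 (1, 0)).eq_of_smulRight ?_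
    exact (hasMFDerivAt_lieExp_smul_zero v).congr_velocity (fun r ↦ by simp [Φ, lieExp_zero]) rfl
  have hw : L (0, 1) = w := by
    refine (hΦ.hasMFDerivAt_comp_line 0 (0, 1)).eq_of_smulRight ?_
    exact (hasMFDerivAt_lieExp_smul_zero w).congr_velocity (fun r ↦ by simp [Φ, lieExp_zero]) rfl
  have hvw : L (1, 1) = (v + w : E) := by
    have := L.map_add (1, 0) (0, 1)
    rw [hv, hw] at this
    refine Eq.trans ?_ this
    simp
  have h1 := hΦ.hasMFDerivAt_comp_line 0 (1, 1)
  have h2 := eq_lieExp_smul_of_map_add (v := v + w)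
    (c := fun t ↦ lieExp (t • v) * lieExp (t • w)) (fun a b ↦ ?_) ?_ 1
  · simpa using h2.symm
  · simp only [lieExp_add_smul]
    rw [mul_assoc, mul_assoc, ← mul_assoc (lieExp (b • v)), hcomm, mul_assoc]
  · exact h1.congr_velocity (fun r ↦ by simp [Φ]) hvw

end Commuting

/-! ### Linear flows -/

section LinearFlow

variable {n : ℕ} (A : (Fin n → ℝ) →L[ℝ] (Fin n → ℝ))

/-- The linear flow `exp (x A)` of an endomorphism `A` of `ℝⁿ`. -/
def linearFlow (x : ℝ) : (Fin n → ℝ) →L[ℝ] (Fin n → ℝ) :=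
  NormedSpace.exp (x • A)

theorem linearFlow_zero : linearFlow A 0 = 1 := by
  simp [linearFlow]

theorem linearFlow_add (a b : ℝ) : linearFlow A (a + b) = linearFlow A a * linearFlow A b := by
  let _ : NormedAlgebra ℚ ((Fin n → ℝ) →L[ℝ] (Fin n → ℝ)) := NormedAlgebra.restrictScalars ℚ ℝ _
  rw [linearFlow, add_smul, NormedSpace.exp_add_of_commute]
  · rfl
  · exact ((Commute.refl A).smul_left a).smul_right b

theorem linearFlow_add_apply (a b : ℝ) (y : Fin n → ℝ) :
    linearFlow A (a + b) y = linearFlow A a (linearFlow A b y) := by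
  rw [linearFlow_add]; rfl

theorem linearFlow_zero_apply (y : Fin n → ℝ) : linearFlow A 0 y = y := by
  rw [linearFlow_zero]; rfl

theorem linearFlow_neg_apply (x : ℝ) (y : Fin n → ℝ) :
    linearFlow A x (linearFlow A (-x) y) = y := by
  rw [← linearFlow_add_apply, add_neg_cancel, linearFlow_zero_apply]

theorem linearFlow_apply_neg (x : ℝ) (y : Fin n → ℝ) :
    linearFlow A (-x) (linearFlow A x y) = y := by
  rw [← linearFlow_add_apply, neg_add_cancel, linearFlow_zero_apply]

theorem hasDerivAt_linearFlow (y : Fin n → ℝ) (x : ℝ) :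
    HasDerivAt (fun x ↦ linearFlow A x y) (A (linearFlow A x y)) x := by
  have h := (hasDerivAt_exp_smul_const' (𝕂 := ℝ) A x).clm_apply (hasDerivAt_const x y)
  simpa [linearFlow] using! h

theorem continuous_linearFlow : Continuous (linearFlow A) :=
  continuous_iff_continuousAt.2 fun x ↦ (hasDerivAt_exp_smul_const' (𝕂 := ℝ) A x).continuousAt

end LinearFlow

/-! ### The semidirect product -/

section Semidirect

variable {n : ℕ}

/-- The semidirect product `ℝⁿ ⋊ ℝ` in which `x : ℝ` acts on `ℝⁿ` by `exp (x A)`. -/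
def SemidirectModel (_ : (Fin n → ℝ) →L[ℝ] (Fin n → ℝ)) : Type := (Fin n → ℝ) × ℝ

variable (A : (Fin n → ℝ) →L[ℝ] (Fin n → ℝ))

instance : TopologicalSpace (SemidirectModel A) := inferInstanceAs (TopologicalSpace (_ × _))

instance : Group (SemidirectModel A) where
  mul p q := (p.1 + linearFlow A p.2 q.1, p.2 + q.2)
  one := ((0 : Fin n → ℝ), (0 : ℝ))
  inv p := (-linearFlow A (-p.2) p.1, -p.2)
  mul_assoc p q r := by
    refine Prod.ext ?_ (add_assoc _ _ _)
    change (p.1 + linearFlow A p.2 q.1) + linearFlow A (p.2 + q.2) r.1 =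
      p.1 + linearFlow A p.2 (q.1 + linearFlow A q.2 r.1)
    rw [linearFlow_add_apply, map_add, add_assoc]
  one_mul p := by
    refine Prod.ext ?_ (zero_add _)
    change 0 + linearFlow A 0 p.1 = p.1
    rw [linearFlow_zero_apply, zero_add]
  mul_one p := by
    refine Prod.ext ?_ (add_zero _)
    change p.1 + linearFlow A p.2 0 = p.1
    rw [map_zero, add_zero]
  inv_mul_cancel p := by
    refine Prod.ext ?_ (neg_add_cancel _)
    change -linearFlow A (-p.2) p.1 + linearFlow A (-p.2) p.1 = 0
    rw [neg_add_cancel]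

instance : IsTopologicalGroup (SemidirectModel A) where
  continuous_mul := by
    have h1 : Continuous fun p : ((Fin n → ℝ) × ℝ) × ((Fin n → ℝ) × ℝ) ↦
        (p.1.1 + linearFlow A p.1.2 p.2.1, p.1.2 + p.2.2) :=
      (Continuous.add (by fun_prop)
        (((continuous_linearFlow A).comp (by fun_prop)).clm_apply (by fun_prop))).prodMk
        (by fun_prop)
    exact h1
  continuous_inv := by
    have h1 : Continuous fun p : (Fin n → ℝ) × ℝ ↦ (-linearFlow A (-p.2) p.1, -p.2) :=
      (((continuous_linearFlow A).comp (by fun_prop)).clm_apply (by fun_prop)).neg.prodMk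
        (by fun_prop)
    exact h1

end Semidirect

/-! ### Coordinates of the second kind -/

section Coordinates

variable {E : Type*} [NormedAddCommGroup E] [NormedSpace ℝ E]
  {G : Type*} [TopologicalSpace G] [ChartedSpace E G] [Group G] [LieGroup 𝓘(ℝ, E) ∞ G]
  {n : ℕ}

/-- The coordinates of the second kind `(y, x) ↦ exp (ι y) exp (x Z)` of a Lie group. -/
def secondKind (ι : (Fin n → ℝ) →ₗ[ℝ] GroupLieAlgebra 𝓘(ℝ, E) G) (Z : GroupLieAlgebra 𝓘(ℝ, E) G)
    (p : (Fin n → ℝ) × ℝ) : G :=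
  lieExp (ι p.1) * lieExp (p.2 • Z)

variable [CompleteSpace E] [T2Space G]
  {A : (Fin n → ℝ) →L[ℝ] (Fin n → ℝ)}
  {ι : (Fin n → ℝ) →ₗ[ℝ] GroupLieAlgebra 𝓘(ℝ, E) G} {Z : GroupLieAlgebra 𝓘(ℝ, E) G}

theorem lieExp_map_add (hι : ∀ y y', ⁅ι y, ι y'⁆ = 0) (y y' : Fin n → ℝ) :
    lieExp (ι (y + y')) = lieExp (ι y) * lieExp (ι y') := by
  rw [map_add, lieExp_add_of_bracket_eq_zero (hι y y')]

/-- On an abelian subalgebra the exponential map is smooth, since it is a product of one-parameter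
groups of basis vectors. -/
theorem contMDiff_lieExp_map (hι : ∀ y y', ⁅ι y, ι y'⁆ = 0) :
    ContMDiff 𝓘(ℝ, Fin n → ℝ) 𝓘(ℝ, E) ∞ (fun y ↦ lieExp (ι y)) := by
  have key : ∀ S : Finset (Fin n), ContMDiff 𝓘(ℝ, Fin n → ℝ) 𝓘(ℝ, E) ∞
      (fun y : Fin n → ℝ ↦ lieExp (ι (∑ j ∈ S, y j • Pi.single j 1))) := by
    intro S
    induction S using Finset.induction_on with
    | empty => simpa using contMDiff_const
    | insert j S hj ih =>
      simp only [Finset.sum_insert hj, lieExp_map_add hι, map_smul]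
      refine ContMDiff.mul ?_ ih
      exact (contMDiff_lieExp_smul (ι (Pi.single j 1))).comp (contDiff_apply ℝ ℝ j).contMDiff
  convert! key Finset.univ using 4 with y
  exact pi_eq_sum_univ' y

/-- The adjoint action of `exp (x Z)` on the image of `ι` is `exp (x A)`, as `ad Z` is `A` there. -/
theorem lieAd_lieExp_map (hA : ∀ y, ⁅Z, ι y⁆ = ι (A y)) (x : ℝ) (y : Fin n → ℝ) :
    lieAd (lieExp (x • Z) : G) (ι y) = ι (linearFlow A x y) := by
  -- `t ↦ Ad (exp (t Z)) (ι (exp (-t A) y))` has zero derivative, hence is constant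
  have key : ∀ (y : Fin n → ℝ) (x : ℝ),
      lieAd (lieExp (x • Z) : G) (ι (linearFlow A (-x) y)) = ι y := by
    intro y x
    let B : ℝ → (Fin n → ℝ) →ₗ[ℝ] E := fun t ↦
      (lieAd (lieExp (t • Z) : G) : E →L[ℝ] E).toLinearMap ∘ₗ (ι : (Fin n → ℝ) →ₗ[ℝ] E)
    have hB : ∀ (z : Fin n → ℝ) (t : ℝ), HasDerivAt (fun t ↦ B t z) (B t (A z)) t := by
      intro z t
      have := hasDerivAt_lieAd Z (ι z) t
      rw [hA] at this
      exact this
    have hz : ∀ t, HasDerivAt (fun t ↦ linearFlow A (-t) y) (-A (linearFlow A (-t) y)) t := by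
      intro t
      simpa using! (hasDerivAt_linearFlow A y (-t)).scomp t (hasDerivAt_neg t)
    have hh : ∀ t, HasDerivAt (fun t ↦ B t (linearFlow A (-t) y)) 0 t := by
      intro t
      have h1 : HasDerivAt (fun t ↦ ∑ i, linearFlow A (-t) y i • B t (Pi.single i 1))
          (∑ i, (linearFlow A (-t) y i • B t (A (Pi.single i 1)) +
            (-A (linearFlow A (-t) y)) i • B t (Pi.single i 1))) t :=
        HasDerivAt.fun_sum fun i _ ↦ (hasDerivAt_pi.1 (hz t) i).smul (hB _ t)
      have h2 : ∀ (C : (Fin n → ℝ) →ₗ[ℝ] E) (z : Fin n → ℝ),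
          C z = ∑ i, z i • C (Pi.single i 1) := by
        intro C z
        conv_lhs => rw [pi_eq_sum_univ' z]
        simp
      convert! h1 using 1
      · ext t
        exact h2 _ _
      · have e1 := h2 (B t ∘ₗ A.toLinearMap) (linearFlow A (-t) y)
        have e2 := h2 (B t) (-A (linearFlow A (-t) y))
        rw [Finset.sum_add_distrib, ← e2]
        simp only [LinearMap.comp_apply, ContinuousLinearMap.coe_coe] at e1
        rw [← e1, map_neg, add_neg_cancel]
    have h3 := is_const_of_deriv_eq_zero (fun r ↦ (hh r).differentiableAt)
      (fun r ↦ (hh r).deriv) x 0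
    refine h3.trans ?_
    change lieAd (lieExp ((0 : ℝ) • Z) : G) (ι (linearFlow A (-0) y)) = ι y
    rw [zero_smul, lieExp_zero, neg_zero, linearFlow_zero_apply, lieAd_one]
  simpa [linearFlow_apply_neg] using key (linearFlow A x y) x

/-- The coordinates of the second kind are a homomorphism from the semidirect product. -/
theorem secondKind_mul (hι : ∀ y y', ⁅ι y, ι y'⁆ = 0) (hA : ∀ y, ⁅Z, ι y⁆ = ι (A y))
    (p q : (Fin n → ℝ) × ℝ) :
    secondKind ι Z p * secondKind ι Z q =
      secondKind ι Z (p.1 + linearFlow A p.2 q.1, p.2 + q.2) := by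
  have h1 := conj_lieExp (lieExp (p.2 • Z)) (ι q.1) 1
  rw [lieAd_lieExp_map hA, one_smul, one_smul] at h1
  simp only [secondKind]
  rw [lieExp_map_add hι, lieExp_add_smul, ← h1]
  group

theorem contMDiff_secondKind (hι : ∀ y y', ⁅ι y, ι y'⁆ = 0) :
    ContMDiff 𝓘(ℝ, (Fin n → ℝ) × ℝ) 𝓘(ℝ, E) ∞ (secondKind ι Z) :=
  ((contMDiff_lieExp_map hι).comp contDiff_fst.contMDiff).mul
    ((contMDiff_lieExp_smul Z).comp contDiff_snd.contMDiff)

/-- The differential of the coordinates of the second kind carries the model of the left-invariant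
frame to the left-invariant frame. -/
theorem mfderiv_secondKind (hι : ∀ y y', ⁅ι y, ι y'⁆ = 0) (hA : ∀ y, ⁅Z, ι y⁆ = ι (A y))
    (p : (Fin n → ℝ) × ℝ) (y : Fin n → ℝ) (a : ℝ) :
    (mfderiv 𝓘(ℝ, (Fin n → ℝ) × ℝ) 𝓘(ℝ, E) (secondKind ι Z) p : (Fin n → ℝ) × ℝ →L[ℝ] E)
      (linearFlow A p.2 y, a) = mulInvariantVectorField (ι y + a • Z) (secondKind ι Z p) := by
  have hΦ := contMDiff_secondKind (Z := Z) hι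
  let L : (Fin n → ℝ) × ℝ →L[ℝ] E :=
    mfderiv 𝓘(ℝ, (Fin n → ℝ) × ℝ) 𝓘(ℝ, E) (secondKind ι Z) p
  have hvel : ∀ v : GroupLieAlgebra 𝓘(ℝ, E) G, HasMFDerivAt 𝓘(ℝ, ℝ) 𝓘(ℝ, E)
      (fun t : ℝ ↦ secondKind ι Z p * lieExp (t • v)) 0
      ((1 : ℝ →L[ℝ] ℝ).smulRight (mulInvariantVectorField v (secondKind ι Z p) : E)) := by
    intro v
    refine ((isMIntegralCurve_lieExp v 0).mul_left_mulInvariantVectorField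
      (secondKind ι Z p)).congr_velocity (fun _ ↦ rfl) ?_
    have key : ∀ g : G, g = 1 → (mulInvariantVectorField v (secondKind ι Z p * g) : E) =
        mulInvariantVectorField v (secondKind ι Z p) := by
      rintro _ rfl
      rw [mul_one]
    exact key _ (by simp [lieExp_zero])
  have h1 : L (linearFlow A p.2 y, 0) = mulInvariantVectorField (ι y) (secondKind ι Z p) := by
    refine (hΦ.hasMFDerivAt_comp_line p _).eq_of_smulRight
      ((hvel (ι y)).congr_velocity (fun t ↦ ?_) rfl)
    have := secondKind_mul hι hA p (t • y, 0)
    simp only [secondKind, zero_smul, lieExp_zero, mul_one, map_smul] at this ⊢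
    simp [this]
  have h2 : L (0, a) = mulInvariantVectorField (a • Z) (secondKind ι Z p) := by
    refine (hΦ.hasMFDerivAt_comp_line p _).eq_of_smulRight
      ((hvel (a • Z)).congr_velocity (fun t ↦ ?_) rfl)
    simp [secondKind, mul_assoc, ← lieExp_add_smul, smul_smul]
  have h3 := L.map_add (linearFlow A p.2 y, 0) (0, a)
  rw [h1, h2] at h3
  rw [mulInvariantVectorField_add]
  refine Eq.trans (congrArg L ?_) h3
  simp

end Coordinates

/-! ### The inverse function theorem for maps into a manifold -/

section InverseFunction

open Filter Topology

variable {E : Type*} [NormedAddCommGroup E] [NormedSpace ℝ E]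
  {D : Type*} [NormedAddCommGroup D] [NormedSpace ℝ D]
  {M : Type*} [TopologicalSpace M] [ChartedSpace E M] {Φ : D → M}

theorem ContMDiff.contDiffAt_extChartAt_comp (hΦ : ContMDiff 𝓘(ℝ, D) 𝓘(ℝ, E) ∞ Φ) (p : D) :
    ContDiffAt ℝ ∞ (fun q ↦ extChartAt 𝓘(ℝ, E) (Φ p) (Φ q)) p := by
  have h := (contMDiffAt_iff.1 (hΦ p)).2
  simpa using! h

theorem ContMDiff.hasFDerivAt_extChartAt_comp (hΦ : ContMDiff 𝓘(ℝ, D) 𝓘(ℝ, E) ∞ Φ) (p : D) :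
    HasFDerivAt (fun q ↦ extChartAt 𝓘(ℝ, E) (Φ p) (Φ q))
      (mfderiv 𝓘(ℝ, D) 𝓘(ℝ, E) Φ p : D →L[ℝ] E) p := by
  let L : D →L[ℝ] E := mfderiv 𝓘(ℝ, D) 𝓘(ℝ, E) Φ p
  have h : HasFDerivWithinAt (fun q ↦ extChartAt 𝓘(ℝ, E) (Φ p) (Φ q)) L (range (id : D → D)) p :=
    ((hΦ.mdifferentiable (by simp)) p).hasMFDerivAt.2
  have h' : HasFDerivAt (fun q ↦ extChartAt 𝓘(ℝ, E) (Φ p) (Φ q)) L p := by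
    rwa [range_id, hasFDerivWithinAt_univ] at h
  exact h'

/-- The inverse function theorem: if the differential of `Φ` at `p` is invertible, then `Φ` is open
at `p` and injective near `p`. -/
theorem ContMDiff.map_nhds_eq_and_injOn [CompleteSpace D]
    (hΦ : ContMDiff 𝓘(ℝ, D) 𝓘(ℝ, E) ∞ Φ) (p : D)
    (L : D ≃L[ℝ] E) (hL : (mfderiv 𝓘(ℝ, D) 𝓘(ℝ, E) Φ p : D →L[ℝ] E) = L.toContinuousLinearMap) :
    map Φ (𝓝 p) = 𝓝 (Φ p) ∧ ∃ U ∈ 𝓝 p, InjOn Φ U := by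
  set f := fun q ↦ extChartAt 𝓘(ℝ, E) (Φ p) (Φ q) with hf
  have h1 : HasStrictFDerivAt f (L : D →L[ℝ] E) p := by
    refine (hΦ.contDiffAt_extChartAt_comp p).hasStrictFDerivAt' ?_ (by simp)
    have h0 := hΦ.hasFDerivAt_extChartAt_comp p
    rw [hL] at h0
    exact h0
  refine ⟨?_, ?_⟩
  · have h2 := h1.map_nhds_eq_of_equiv
    have h3 : map (extChartAt 𝓘(ℝ, E) (Φ p)).symm (𝓝 (f p)) = 𝓝 (Φ p) := by
      have := map_extChartAt_symm_nhdsWithin_range (I := 𝓘(ℝ, E)) (Φ p)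
      simpa using! this
    rw [← h3, ← h2, map_map]
    refine Filter.map_congr ?_
    filter_upwards [hΦ.continuous.continuousAt.preimage_mem_nhds
      (extChartAt_source_mem_nhds (I := 𝓘(ℝ, E)) (Φ p))] with q hq
    exact ((extChartAt 𝓘(ℝ, E) (Φ p)).left_inv hq).symm
  · refine ⟨(h1.toOpenPartialHomeomorph f).source,
      (h1.toOpenPartialHomeomorph f).open_source.mem_nhds h1.mem_toOpenPartialHomeomorph_source,
      fun a ha b hb hab ↦ (h1.toOpenPartialHomeomorph f).injOn ha hb ?_⟩
    simp [hf, hab]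

/-- The inverse of a smooth homeomorphism with invertible differentials is smooth. -/
theorem Homeomorph.contMDiff_symm_of_mfderiv [CompleteSpace D] [IsManifold 𝓘(ℝ, E) ∞ M] (Φ : D ≃ₜ M)
    (hΦ : ContMDiff 𝓘(ℝ, D) 𝓘(ℝ, E) ∞ Φ)
    (hL : ∀ p, ∃ L : D ≃L[ℝ] E,
      (mfderiv 𝓘(ℝ, D) 𝓘(ℝ, E) Φ p : D →L[ℝ] E) = L.toContinuousLinearMap) :
    ContMDiff 𝓘(ℝ, E) 𝓘(ℝ, D) ∞ Φ.symm := by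
  intro g
  obtain ⟨p, rfl⟩ := Φ.surjective g
  obtain ⟨L, hL⟩ := hL p
  let h : OpenPartialHomeomorph D E := Φ.toOpenPartialHomeomorph.trans (chartAt E (Φ p))
  have hp : h.symm (chartAt E (Φ p) (Φ p)) = p := by
    simp [h]
  have h1 : ContDiffAt ℝ ∞ h.symm (chartAt E (Φ p) (Φ p)) := by
    refine h.contDiffAt_symm (f₀' := L) (by simp [h]) ?_ ?_
    · have h0 := hΦ.hasFDerivAt_extChartAt_comp p
      rw [hL] at h0
      rw [hp]
      exact h0
    · rw [hp]
      exact hΦ.contDiffAt_extChartAt_comp p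
  rw [contMDiffAt_iff]
  refine ⟨Φ.symm.continuous.continuousAt, ?_⟩
  simpa [h] using! h1

end InverseFunction

/-! ### Coordinates of the second kind on a simply connected group -/

section Bijective

open Filter Topology

variable {E : Type*} [NormedAddCommGroup E] [NormedSpace ℝ E]
  {G : Type*} [TopologicalSpace G] [ChartedSpace E G] [Group G] [LieGroup 𝓘(ℝ, E) ∞ G]
  {n : ℕ} [CompleteSpace E] [T2Space G]
  {A : (Fin n → ℝ) →L[ℝ] (Fin n → ℝ)}
  {ι : (Fin n → ℝ) →ₗ[ℝ] GroupLieAlgebra 𝓘(ℝ, E) G} {Z : GroupLieAlgebra 𝓘(ℝ, E) G}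

/-- Since the differential carries a frame to the left-invariant frame of a basis, it is invertible.
-/
theorem exists_equiv_mfderiv_secondKind (hι : ∀ y y', ⁅ι y, ι y'⁆ = 0)
    (hA : ∀ y, ⁅Z, ι y⁆ = ι (A y))
    (hb : Function.Bijective fun p : (Fin n → ℝ) × ℝ ↦ ι p.1 + p.2 • Z) (p : (Fin n → ℝ) × ℝ) :
    ∃ L : ((Fin n → ℝ) × ℝ) ≃L[ℝ] E,
      (mfderiv 𝓘(ℝ, (Fin n → ℝ) × ℝ) 𝓘(ℝ, E) (secondKind ι Z) p : (Fin n → ℝ) × ℝ →L[ℝ] E) =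
        L.toContinuousLinearMap := by
  let e : ((Fin n → ℝ) × ℝ) →ₗ[ℝ] E :=
    (ι : (Fin n → ℝ) →ₗ[ℝ] E).coprod (LinearMap.toSpanSingleton ℝ E (Z : E))
  let e' : ((Fin n → ℝ) × ℝ) ≃ₗ[ℝ] E := LinearEquiv.ofBijective e hb
  have : FiniteDimensional ℝ E := e'.finiteDimensional
  let L : (Fin n → ℝ) × ℝ →L[ℝ] E :=
    mfderiv 𝓘(ℝ, (Fin n → ℝ) × ℝ) 𝓘(ℝ, E) (secondKind ι Z) p
  have hinj : Function.Injective L.toLinearMap := by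
    rw [← LinearMap.ker_eq_bot, LinearMap.ker_eq_bot']
    rintro ⟨y, a⟩ h
    have h1 := mfderiv_secondKind hι hA p (linearFlow A (-p.2) y) a
    rw [linearFlow_neg_apply] at h1
    have h2 : mulInvariantVectorField (ι (linearFlow A (-p.2) y) + a • Z) (secondKind ι Z p) =
        mulInvariantVectorField 0 (secondKind ι Z p) := by
      rw [← h1]
      refine Eq.trans h ?_
      exact (map_zero (mfderiv 𝓘(ℝ, E) 𝓘(ℝ, E) (fun x : G ↦ secondKind ι Z p * x) 1)).symm
    have h3 := mulInvariantVectorField_injective _ h2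
    have h4 := @hb.1 (linearFlow A (-p.2) y, a) (0, 0) (by simpa using h3)
    have h5 : linearFlow A (-p.2) y = 0 := congrArg Prod.fst h4
    have h6 := linearFlow_neg_apply A p.2 y
    rw [h5, map_zero] at h6
    exact Prod.ext h6.symm (Prod.ext_iff.1 h4).2
  have hsurj := (LinearMap.injective_iff_surjective_of_finrank_eq_finrank e'.finrank_eq).1 hinj
  exact ⟨(LinearEquiv.ofBijective L.toLinearMap ⟨hinj, hsurj⟩).toContinuousLinearEquiv, rfl⟩

/-- `secondKind ι Z` as a homomorphism from the semidirect product. -/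
def secondKindHom (hι : ∀ y y', ⁅ι y, ι y'⁆ = 0) (hA : ∀ y, ⁅Z, ι y⁆ = ι (A y)) :
    SemidirectModel A →* G :=
  MonoidHom.mk' (fun p ↦ secondKind ι Z p) fun p q ↦ (secondKind_mul hι hA p q).symm

/-- For simply connected `G`, the coordinates of the second kind are bijective: as a homomorphism
with discrete kernel they are a covering map onto `G`. -/
theorem bijective_secondKind [SimplyConnectedSpace G] (hι : ∀ y y', ⁅ι y, ι y'⁆ = 0)
    (hA : ∀ y, ⁅Z, ι y⁆ = ι (A y))
    (hb : Function.Bijective fun p : (Fin n → ℝ) × ℝ ↦ ι p.1 + p.2 • Z) :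
    IsOpenMap (secondKind ι Z) ∧ Function.Bijective (secondKind ι Z) := by
  have hΦ := contMDiff_secondKind (Z := Z) hι
  have hloc := fun p ↦ hΦ.map_nhds_eq_and_injOn p
    (exists_equiv_mfderiv_secondKind hι hA hb p).choose
    (exists_equiv_mfderiv_secondKind hι hA hb p).choose_spec
  have hopen : IsOpenMap (secondKind ι Z) :=
    IsOpenMap.of_nhds_le fun p ↦ (hloc p).1.ge
  have : IsTopologicalGroup G := topologicalGroup_of_lieGroup 𝓘(ℝ, E) ∞
  have : LocallyPathConnectedSpace G := ChartedSpace.locallyPathConnectedSpace E G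
  let f := secondKindHom hι hA
  have hf : ∀ p, f p = secondKind ι Z p := fun _ ↦ rfl
  -- the range is an open subgroup of a connected group
  have hsurj : Function.Surjective f := by
    have h1 : IsOpen (f.range : Set G) := by
      rw [MonoidHom.coe_range]
      exact hopen.isOpen_range
    have h2 : IsClopen (f.range : Set G) := ⟨f.range.isClosed_of_isOpen h1, h1⟩
    have h3 := h2.eq_univ ⟨1, one_mem _⟩
    exact fun g ↦ by simpa using! (h3.ge (mem_univ g))
  have hquot : IsQuotientMap f := hopen.isQuotientMap hΦ.continuous hsurj
  have hdisc : IsDiscrete (f.ker : Set (SemidirectModel A)) := by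
    rw [isDiscrete_iff_forall_mem_exists_isOpen]
    intro y hy
    obtain ⟨U, hU, hinj⟩ := (hloc y).2
    obtain ⟨W, hWU, hW, hyW⟩ := mem_nhds_iff.1 hU
    refine ⟨W, hW, Subset.antisymm ?_ (singleton_subset_iff.2 ⟨hyW, hy⟩)⟩
    rintro z ⟨hz, hz'⟩
    have h1 : f z = f y := (MonoidHom.mem_ker.1 hz').trans (MonoidHom.mem_ker.1 hy).symm
    exact hinj (hWU hz) (hWU hyW) h1
  have hcov := (hquot.isQuotientCoveringMap_of_isDiscrete_ker_monoidHom hdisc).isCoveringMap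
  -- the section of the covering through `1` is a two-sided inverse by uniqueness of lifts
  obtain ⟨F, ⟨hF1, hF2⟩, -⟩ := hcov.existsUnique_continuousMap_lifts (ContinuousMap.id G) 1 1
    (map_one f)
  refine ⟨hopen, ?_, hsurj⟩
  have : PreconnectedSpace (SemidirectModel A) :=
    inferInstanceAs (PreconnectedSpace ((Fin n → ℝ) × ℝ))
  have hfc : Continuous f := hΦ.continuous
  have h5 : F ∘ f = id := by
    refine hcov.eq_of_comp_eq (F.continuous.comp hfc) continuous_id ?_ 1 (by simp [hF1])
    rw [← Function.comp_assoc, hF2]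
    rfl
  exact Function.LeftInverse.injective (congrFun h5)

theorem exists_contMDiff_inverse_secondKind [SimplyConnectedSpace G]
    (hι : ∀ y y', ⁅ι y, ι y'⁆ = 0) (hA : ∀ y, ⁅Z, ι y⁆ = ι (A y))
    (hb : Function.Bijective fun p : (Fin n → ℝ) × ℝ ↦ ι p.1 + p.2 • Z) :
    ∃ Ψ : G → (Fin n → ℝ) × ℝ, ContMDiff 𝓘(ℝ, E) 𝓘(ℝ, (Fin n → ℝ) × ℝ) ∞ Ψ ∧
      Function.LeftInverse Ψ (secondKind ι Z) ∧ Function.RightInverse Ψ (secondKind ι Z) := by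
  have hΦ := contMDiff_secondKind (Z := Z) hι
  obtain ⟨h1, h2⟩ := bijective_secondKind hι hA hb
  have : IsManifold 𝓘(ℝ, E) ∞ G := inferInstance
  let e : (Fin n → ℝ) × ℝ ≃ₜ G :=
    (Equiv.ofBijective _ h2).toHomeomorphOfContinuousOpen hΦ.continuous h1
  exact ⟨e.symm, e.contMDiff_symm_of_mfderiv hΦ (exists_equiv_mfderiv_secondKind hι hA hb),
    e.left_inv, e.right_inv⟩

/-- The inverse of the coordinates of the second kind carries the left-invariant frame to its model.
-/
theorem mfderiv_inverse_secondKind (hι : ∀ y y', ⁅ι y, ι y'⁆ = 0) (hA : ∀ y, ⁅Z, ι y⁆ = ι (A y))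
    {Ψ : G → (Fin n → ℝ) × ℝ} (hΨ : ContMDiff 𝓘(ℝ, E) 𝓘(ℝ, (Fin n → ℝ) × ℝ) ∞ Ψ)
    (hl : Function.LeftInverse Ψ (secondKind ι Z)) (p : (Fin n → ℝ) × ℝ)
    (y : Fin n → ℝ) (a : ℝ) :
    (mfderiv 𝓘(ℝ, E) 𝓘(ℝ, (Fin n → ℝ) × ℝ) Ψ (secondKind ι Z p) : E →L[ℝ] (Fin n → ℝ) × ℝ)
      (mulInvariantVectorField (ι y + a • Z) (secondKind ι Z p)) = (linearFlow A p.2 y, a) := by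
  have hΦ := contMDiff_secondKind (Z := Z) hι
  have h1 := (((hΨ.mdifferentiable (by simp)) (secondKind ι Z p)).hasMFDerivAt.comp p
    ((hΦ.mdifferentiable (by simp)) p).hasMFDerivAt)
  have h2 : Ψ ∘ secondKind ι Z = id := funext hl
  rw [h2] at h1
  have h3 := hasMFDerivAt_unique h1 (hasMFDerivAt_id p)
  rw [← mfderiv_secondKind hι hA p y a]
  exact DFunLike.congr_fun h3 (linearFlow A p.2 y, a)

end Bijective

/-! ### Absolutely continuous functions -/

section AbsoluteContinuity

open Filter Topology
open scoped NNReal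

theorem AbsolutelyContinuousOnInterval.of_dist_le {X Y : Type*} [PseudoMetricSpace X]
    [PseudoMetricSpace Y] {f : ℝ → X} {g : ℝ → Y} {a b : ℝ} (K : ℝ)
    (hf : AbsolutelyContinuousOnInterval f a b)
    (h : ∀ s ∈ uIcc a b, ∀ t ∈ uIcc a b, dist (g s) (g t) ≤ K * dist (f s) (f t)) :
    AbsolutelyContinuousOnInterval g a b := by
  have h1 : Tendsto (fun I : ℕ × (ℕ → ℝ × ℝ) ↦
      K * ∑ i ∈ Finset.range I.1, dist (f (I.2 i).1) (f (I.2 i).2))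
      (totalLengthFilter ⊓ 𝓟 (disjWithin a b)) (𝓝 0) := by
    simpa using! Tendsto.const_mul K hf
  refine squeeze_zero' (Eventually.of_forall fun I ↦ Finset.sum_nonneg fun i _ ↦ dist_nonneg)
    ?_ h1
  filter_upwards [mem_inf_of_right (mem_principal_self _)] with I hI
  rw [Finset.mul_sum]
  exact Finset.sum_le_sum fun i hi ↦ h _ (hI.1 i hi).1 _ (hI.1 i hi).2

theorem AbsolutelyContinuousOnInterval.congr {X : Type*} [PseudoMetricSpace X] {f g : ℝ → X}
    {a b : ℝ} (hf : AbsolutelyContinuousOnInterval f a b) (h : EqOn g f (uIcc a b)) :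
    AbsolutelyContinuousOnInterval g a b :=
  hf.of_dist_le 1 fun s hs t ht ↦ by rw [h hs, h ht, one_mul]

/-- A primitive of a vector-valued integrable function is absolutely continuous: its increments are
dominated by those of the primitive of the norm. -/
theorem IntervalIntegrable.absolutelyContinuousOnInterval_integral {F : Type*}
    [NormedAddCommGroup F] [NormedSpace ℝ F] {g : ℝ → F} {a b : ℝ}
    (hg : IntervalIntegrable g volume a b) :
    AbsolutelyContinuousOnInterval (fun t ↦ ∫ τ in a..t, g τ) a b := by
  refine (hg.norm.absolutelyContinuousOnInterval_intervalIntegral left_mem_uIcc).of_dist_le 1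
    fun s hs t ht ↦ ?_
  have h1 : ∀ r ∈ uIcc a b, IntervalIntegrable g volume a r := fun r hr ↦
    hg.mono_set (uIcc_subset_uIcc_left hr)
  rw [dist_comm, dist_comm (∫ τ in a..s, ‖g τ‖), dist_eq_norm, Real.dist_eq, one_mul,
    intervalIntegral.integral_interval_sub_left (h1 t ht) (h1 s hs),
    intervalIntegral.integral_interval_sub_left (h1 t ht).norm (h1 s hs).norm]
  exact intervalIntegral.norm_integral_le_abs_integral_norm

/-- A `C¹` map carries absolutely continuous curves to absolutely continuous curves. -/
theorem ContDiffOn.comp_absolutelyContinuousOnInterval {F F' : Type*}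
    [NormedAddCommGroup F] [NormedSpace ℝ F] [NormedAddCommGroup F'] [NormedSpace ℝ F']
    {f : F → F'} {U : Set F} (hU : IsOpen U) (hf : ContDiffOn ℝ 1 f U) {z : ℝ → F} {a b : ℝ}
    (hz : AbsolutelyContinuousOnInterval z a b) (hzU : MapsTo z (uIcc a b) U) :
    AbsolutelyContinuousOnInterval (fun t ↦ f (z t)) a b := by
  have h1 : LocallyLipschitzOn (z '' uIcc a b) f := by
    rintro _ ⟨t, ht, rfl⟩
    obtain ⟨K, V, hV, hK⟩ := ((hf _ (hzU ht)).contDiffAt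
      (hU.mem_nhds (hzU ht))).exists_lipschitzOnWith
    exact ⟨K, V, mem_nhdsWithin_of_mem_nhds hV, hK⟩
  obtain ⟨K, hK⟩ := h1.exists_lipschitzOnWith_of_compact
    (isCompact_uIcc.image_of_continuousOn hz.continuousOn)
  exact hz.of_dist_le K fun s hs t ht ↦
    hK.dist_le_mul _ (mem_image_of_mem z hs) _ (mem_image_of_mem z ht)

/-- The fundamental theorem of calculus holds for `f` on `[a, b]`. Unlike the definition of
absolute continuity, this form passes immediately to unions of adjacent intervals. -/
def IsIntegralOfDeriv (f : ℝ → ℝ) (a b : ℝ) : Prop :=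
  IntervalIntegrable (deriv f) volume a b ∧
    ∀ t ∈ Icc a b, ∫ τ in a..t, deriv f τ = f t - f a

theorem AbsolutelyContinuousOnInterval.isIntegralOfDeriv {f : ℝ → ℝ} {a b : ℝ} (hab : a ≤ b)
    (hf : AbsolutelyContinuousOnInterval f a b) : IsIntegralOfDeriv f a b := by
  refine ⟨hf.intervalIntegrable_deriv, fun t ht ↦ ?_⟩
  refine (hf.mono ?_).integral_deriv_eq_sub
  rw [← uIcc_of_le hab] at ht
  exact uIcc_subset_uIcc_left ht

theorem IsIntegralOfDeriv.trans {f : ℝ → ℝ} {a b c : ℝ} (hab : a ≤ b) (hbc : b ≤ c)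
    (h1 : IsIntegralOfDeriv f a b) (h2 : IsIntegralOfDeriv f b c) : IsIntegralOfDeriv f a c := by
  refine ⟨h1.1.trans h2.1, fun t ht ↦ ?_⟩
  rcases le_total t b with htb | htb
  · exact h1.2 t ⟨ht.1, htb⟩
  · have h3 : IntervalIntegrable (deriv f) volume b t := h2.1.mono_set (by
      rw [uIcc_of_le hbc, uIcc_of_le htb]
      exact Icc_subset_Icc_right ht.2)
    rw [← intervalIntegral.integral_add_adjacent_intervals h1.1 h3, h1.2 b ⟨hab, le_rfl⟩,
      h2.2 t ⟨htb, ht.2⟩]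
    ring

end AbsoluteContinuity

/-! ### Absolutely continuous curves in a manifold -/

section ACCurve

open Filter Topology

variable {E : Type*} [NormedAddCommGroup E] [NormedSpace ℝ E]
  {M : Type*} [TopologicalSpace M] [ChartedSpace E M]

/-- A smooth function along an absolutely continuous curve satisfies the fundamental theorem of
calculus: this holds on subintervals mapped into a chart domain, and finitely many of them cover
`[0, 1]`. -/
theorem IsACCurve.isIntegralOfDeriv_comp [IsManifold 𝓘(ℝ, E) ∞ M] {γ : ℝ → M}
    (hγ : IsACCurve (E := E) γ) {f : M → ℝ} (hf : ContMDiff 𝓘(ℝ, E) 𝓘(ℝ, ℝ) ∞ f) :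
    IsIntegralOfDeriv (fun t ↦ f (γ t)) 0 1 := by
  have hloc : ∀ (p : M) (a b : ℝ), 0 ≤ a → a ≤ b → b ≤ 1 →
      (∀ t ∈ Icc a b, γ t ∈ (chartAt E p).source) → IsIntegralOfDeriv (fun t ↦ f (γ t)) a b := by
    intro p a b ha hab hb h
    have h1 : ContDiffOn ℝ ∞ (f ∘ (chartAt E p).symm) (chartAt E p).target := by
      rw [← contMDiffOn_iff_contDiffOn]
      exact hf.comp_contMDiffOn (contMDiffOn_chart_symm (I := 𝓘(ℝ, E)))
    have h2 := (h1.of_le (m := 1) (by simp)).comp_absolutelyContinuousOnInterval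
      (chartAt E p).open_target (hγ.2 p a b ha hab hb h) (by
        rw [uIcc_of_le hab]
        exact fun t ht ↦ (chartAt E p).map_source (h t ht))
    refine (h2.congr ?_).isIntegralOfDeriv hab
    rw [uIcc_of_le hab]
    intro t ht
    simp [(chartAt E p).left_inv (h t ht)]
  obtain ⟨t, ht0, htm, ⟨m, hm⟩, hc⟩ := exists_monotone_Icc_subset_open_cover_Icc
    (zero_le_one (α := ℝ)) (c := fun p : M ↦ (fun t : Icc (0 : ℝ) 1 ↦ γ t) ⁻¹' (chartAt E p).source)
    (fun p ↦ (chartAt E p).open_source.preimage hγ.1.domRestrict)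
    (fun t _ ↦ mem_iUnion.2 ⟨γ t, mem_chart_source E (γ t)⟩)
  have key : ∀ k, IsIntegralOfDeriv (fun t ↦ f (γ t)) 0 (t k) := by
    intro k
    induction k with
    | zero =>
      rw [ht0]
      refine ⟨IntervalIntegrable.refl, fun t ht ↦ ?_⟩
      obtain rfl : t = 0 := le_antisymm ht.2 ht.1
      simp
    | succ k ih =>
      obtain ⟨p, hp⟩ := hc k
      have hle : (t k : ℝ) ≤ t (k + 1) := htm (Nat.le_succ k)
      refine ih.trans (t k).2.1 hle (hloc p _ _ (t k).2.1 hle (t (k + 1)).2.2 fun r hr ↦ ?_)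
      exact @hp ⟨r, (t k).2.1.trans hr.1, hr.2.trans (t (k + 1)).2.2⟩ ⟨hr.1, hr.2⟩
  simpa [hm m le_rfl] using key m

/-- A smooth map carries absolutely continuous curves in a normed space to absolutely continuous
curves in a manifold. -/
theorem ContMDiff.isACCurve_comp [IsManifold 𝓘(ℝ, E) ∞ M] {D : Type*} [NormedAddCommGroup D]
    [NormedSpace ℝ D] {Φ : D → M} (hΦ : ContMDiff 𝓘(ℝ, D) 𝓘(ℝ, E) ∞ Φ) {z : ℝ → D}
    (hz : AbsolutelyContinuousOnInterval z 0 1) : IsACCurve (E := E) fun t ↦ Φ (z t) := by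
  constructor
  · have := hz.continuousOn
    rw [uIcc_of_le zero_le_one] at this
    exact hΦ.continuous.comp_continuousOn this
  · intro p a b ha hab hb h
    have h1 : ContDiffOn ℝ ∞ (chartAt E p ∘ Φ) (Φ ⁻¹' (chartAt E p).source) := by
      rw [← contMDiffOn_iff_contDiffOn]
      exact (contMDiffOn_chart (I := 𝓘(ℝ, E))).comp hΦ.contMDiffOn Subset.rfl
    refine (h1.of_le (m := 1) (by simp)).comp_absolutelyContinuousOnInterval
      ((chartAt E p).open_source.preimage hΦ.continuous) (hz.mono ?_) ?_
    · rw [uIcc_of_le hab, uIcc_of_le zero_le_one]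
      exact Icc_subset_Icc ha hb
    · rw [uIcc_of_le hab]
      exact h

end ACCurve

/-! ### Velocities of curves in a manifold -/

section Velocity

variable {E : Type*} [NormedAddCommGroup E] [NormedSpace ℝ E]
  {E' : Type*} [NormedAddCommGroup E'] [NormedSpace ℝ E']
  {M : Type*} [TopologicalSpace M] [ChartedSpace E M]
  {N : Type*} [TopologicalSpace N] [ChartedSpace E' N]

theorem hasMFDerivAt_smulRight_iff_hasDerivAt {c : ℝ → E} {e : E} {t : ℝ} :
    HasMFDerivAt 𝓘(ℝ, ℝ) 𝓘(ℝ, E) c t ((1 : ℝ →L[ℝ] ℝ).smulRight (e : E)) ↔ HasDerivAt c e t := by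
  refine hasMFDerivAt_iff_hasFDerivAt.trans ?_
  have : (1 : ℝ →L[ℝ] ℝ).smulRight e = ContinuousLinearMap.toSpanSingleton ℝ e := by
    ext
    simp
  change HasFDerivAt c ((1 : ℝ →L[ℝ] ℝ).smulRight e) t ↔ _
  rw [hasDerivAt_iff_hasFDerivAt, this]

theorem HasMFDerivAt.comp_velocity {c : ℝ → M} {f : M → N} {e : E} {t : ℝ}
    (h : HasMFDerivAt 𝓘(ℝ, ℝ) 𝓘(ℝ, E) c t ((1 : ℝ →L[ℝ] ℝ).smulRight (e : E)))
    (hf : MDifferentiableAt 𝓘(ℝ, E) 𝓘(ℝ, E') f (c t)) :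
    HasMFDerivAt 𝓘(ℝ, ℝ) 𝓘(ℝ, E') (fun t ↦ f (c t)) t
      ((1 : ℝ →L[ℝ] ℝ).smulRight
        ((mfderiv 𝓘(ℝ, E) 𝓘(ℝ, E') f (c t) : E →L[ℝ] E') e)) := by
  refine (hf.hasMFDerivAt.comp t h).congr_mfderiv ?_
  exact ContinuousLinearMap.ext fun a : ℝ ↦
    ContinuousLinearMap.map_smul (mfderiv 𝓘(ℝ, E) 𝓘(ℝ, E') f (c t) : E →L[ℝ] E') a e

end Velocity

/-! ### Curves with a given control in the coordinates of the second kind -/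

section ControlPath

variable {n : ℕ} (A : (Fin n → ℝ) →L[ℝ] (Fin n → ℝ)) (e : Fin n → ℝ) (u : Control 2)

/-- The curve in the coordinates of the second kind with control `u`: it starts at `0` and has
velocity `(u₂ exp (x A) e, u₁)` at `(y, x)`. -/
def controlPath (t : ℝ) : (Fin n → ℝ) × ℝ :=
  (∫ τ in 0..t, u τ 1 • linearFlow A (∫ r in 0..τ, u r 0) e, ∫ τ in 0..t, u τ 0)

theorem Control.intervalIntegrable_apply (i : Fin 2) :
    IntervalIntegrable (fun t ↦ u t i) volume 0 1 := by
  have h1 : Integrable u (volume.restrict (Icc (0 : ℝ) 1)) := L1.integrable_coeFn u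
  rw [intervalIntegrable_iff_integrableOn_Icc_of_le zero_le_one]
  exact (EuclideanSpace.proj i : EuclideanSpace ℝ (Fin 2) →L[ℝ] ℝ).integrable_comp h1

theorem Control.absolutelyContinuousOnInterval_integral (i : Fin 2) :
    AbsolutelyContinuousOnInterval (fun t ↦ ∫ τ in 0..t, u τ i) 0 1 :=
  (u.intervalIntegrable_apply i).absolutelyContinuousOnInterval_integral

theorem Control.intervalIntegrable_smul_linearFlow :
    IntervalIntegrable (fun τ ↦ u τ 1 • linearFlow A (∫ r in 0..τ, u r 0) e) volume 0 1 :=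
  (Control.intervalIntegrable_apply u 1).smul_continuousOn
    (((continuous_linearFlow A).comp_continuousOn
      (Control.absolutelyContinuousOnInterval_integral u 0).continuousOn).clm_apply
        continuousOn_const)

theorem absolutelyContinuousOnInterval_controlPath :
    AbsolutelyContinuousOnInterval (controlPath A e u) 0 1 := by
  have h1 : IntervalIntegrable (fun τ ↦ (u τ 1 • linearFlow A (∫ r in 0..τ, u r 0) e, u τ 0))
      volume 0 1 := by
    have h2 := Control.intervalIntegrable_smul_linearFlow A e u
    have h3 := Control.intervalIntegrable_apply u 0
    rw [intervalIntegrable_iff] at *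
    exact h2.prodMk h3
  refine h1.absolutelyContinuousOnInterval_integral.congr fun t ht ↦ ?_
  have h4 := h1.mono_set (uIcc_subset_uIcc_left ht)
  exact Prod.ext (ContinuousLinearMap.fst ℝ (Fin n → ℝ) ℝ|>.intervalIntegral_comp_comm h4)
    (ContinuousLinearMap.snd ℝ (Fin n → ℝ) ℝ|>.intervalIntegral_comp_comm h4)

theorem controlPath_zero : controlPath A e u 0 = 0 := by
  simp [controlPath]

theorem ae_hasDerivAt_controlPath : ∀ᵐ t ∂volume.restrict (Icc (0 : ℝ) 1),
    HasDerivAt (controlPath A e u)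
      (linearFlow A (controlPath A e u t).2 (u t 1 • e), u t 0) t := by
  have h1 := (Control.intervalIntegrable_smul_linearFlow A e u).ae_hasDerivAt_integral
  have h2 := (Control.intervalIntegrable_apply u 0).ae_hasDerivAt_integral
  rw [ae_restrict_iff' measurableSet_Icc]
  filter_upwards [h1, h2] with t h1 h2 ht
  rw [uIcc_of_le zero_le_one] at h1 h2
  rw [map_smul]
  exact (h1 ht 0 ⟨le_rfl, zero_le_one⟩).prodMk (h2 ht 0 ⟨le_rfl, zero_le_one⟩)

end ControlPath

/-! ### Horizontal curves in the coordinates of the second kind -/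

section Horizontal

variable {E : Type*} [NormedAddCommGroup E] [NormedSpace ℝ E]
  {G : Type*} [TopologicalSpace G] [ChartedSpace E G] [Group G] {n : ℕ}
  {A : (Fin n → ℝ) →L[ℝ] (Fin n → ℝ)}
  {ι : (Fin n → ℝ) →ₗ[ℝ] GroupLieAlgebra 𝓘(ℝ, E) G} {Z : GroupLieAlgebra 𝓘(ℝ, E) G}

/-- The velocity of a horizontal curve at the identity, in terms of `ι` and `Z`. -/
theorem sum_smul_frame (e : Fin n → ℝ) (u : Control 2) (t : ℝ) :
    ∑ i, u t i • (![Z, ι e] : Fin 2 → GroupLieAlgebra 𝓘(ℝ, E) G) i =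
      ι (u t 1 • e) + u t 0 • Z := by
  rw [Fin.sum_univ_two, map_smul, add_comm]
  rfl

variable [LieGroup 𝓘(ℝ, E) ∞ G] [CompleteSpace E] [T2Space G]

/-- Existence of horizontal curves. -/
theorem isHorizontalCurve_secondKind_controlPath (hι : ∀ y y', ⁅ι y, ι y'⁆ = 0)
    (hA : ∀ y, ⁅Z, ι y⁆ = ι (A y)) (e : Fin n → ℝ) (u : Control 2) :
    IsHorizontalCurve ![Z, ι e] u fun t ↦ secondKind ι Z (controlPath A e u t) := by
  have : IsManifold 𝓘(ℝ, E) ∞ G := inferInstance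
  have hΦ := contMDiff_secondKind (Z := Z) hι
  refine ⟨hΦ.isACCurve_comp (absolutelyContinuousOnInterval_controlPath A e u), ?_, ?_⟩
  · simp [controlPath_zero, secondKind, lieExp_zero]
  · filter_upwards [ae_hasDerivAt_controlPath A e u] with t ht
    refine ((hasMFDerivAt_smulRight_iff_hasDerivAt.2 ht).comp_velocity
      (hΦ.mdifferentiable (by simp) _)).congr_velocity (fun _ ↦ rfl) ?_
    rw [mfderiv_secondKind hι hA, sum_smul_frame]

/-- Uniqueness of horizontal curves: in the coordinates of the second kind the horizontal curve with
control `u` is `controlPath A e u` on `[0, 1]`. -/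
theorem IsHorizontalCurve.eq_controlPath (hι : ∀ y y', ⁅ι y, ι y'⁆ = 0)
    (hA : ∀ y, ⁅Z, ι y⁆ = ι (A y)) {Ψ : G → (Fin n → ℝ) × ℝ}
    (hΨ : ContMDiff 𝓘(ℝ, E) 𝓘(ℝ, (Fin n → ℝ) × ℝ) ∞ Ψ)
    (hl : Function.LeftInverse Ψ (secondKind ι Z)) (hr : Function.RightInverse Ψ (secondKind ι Z))
    {e : Fin n → ℝ} {u : Control 2} {γ : ℝ → G} (hγ : IsHorizontalCurve ![Z, ι e] u γ) {t : ℝ}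
    (ht : t ∈ Icc (0 : ℝ) 1) : Ψ (γ t) = controlPath A e u t := by
  have : IsManifold 𝓘(ℝ, E) ∞ G := inferInstance
  obtain ⟨h1, h2, h3⟩ := hγ
  have hΨ1 : Ψ 1 = 0 := by
    rw [← hl 0]
    simp [secondKind, lieExp_zero]
  -- the coordinates of `γ` satisfy the same differential equation as `controlPath A e u`
  have hder : ∀ᵐ τ ∂volume.restrict (Icc (0 : ℝ) 1), HasDerivAt (fun τ ↦ Ψ (γ τ))
      (u τ 1 • linearFlow A (Ψ (γ τ)).2 e, u τ 0) τ := by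
    filter_upwards [h3] with τ hτ
    rw [← hasMFDerivAt_smulRight_iff_hasDerivAt]
    refine (hτ.comp_velocity (hΨ.mdifferentiable (by simp) _)).congr_velocity (fun _ ↦ rfl) ?_
    have h4 := mfderiv_inverse_secondKind hι hA hΨ hl (Ψ (γ τ)) (u τ 1 • e) (u τ 0)
    rw [hr (γ τ), map_smul (linearFlow A _)] at h4
    rw [← h4, sum_smul_frame]
  have key : ∀ (f : (Fin n → ℝ) × ℝ →L[ℝ] ℝ), ∀ t ∈ Icc (0 : ℝ) 1,
      f (Ψ (γ t)) = ∫ τ in 0..t, f (u τ 1 • linearFlow A (Ψ (γ τ)).2 e, u τ 0) := by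
    intro f t ht
    have h4 := (h1.isIntegralOfDeriv_comp (f.contMDiff.comp hΨ)).2 t ht
    simp only [Function.comp_apply, h2, hΨ1, map_zero, sub_zero] at h4
    rw [← h4]
    refine intervalIntegral.integral_congr_ae ?_
    rw [ae_restrict_iff' measurableSet_Icc] at hder
    filter_upwards [hder] with τ hτ hτ'
    rw [uIoc_of_le ht.1] at hτ'
    exact (f.hasFDerivAt.comp_hasDerivAt τ (hτ ⟨hτ'.1.le, hτ'.2.trans ht.2⟩)).deriv
  -- the equation for `x` does not involve `y`, and the one for `y` involves `x` alone
  have hx : ∀ t ∈ Icc (0 : ℝ) 1, (Ψ (γ t)).2 = ∫ τ in 0..t, u τ 0 :=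
    key (ContinuousLinearMap.snd ℝ _ _)
  refine Prod.ext (funext fun j ↦ ?_) (hx t ht)
  have h5 := key ((ContinuousLinearMap.proj j).comp (ContinuousLinearMap.fst ℝ _ _)) t ht
  have h6 := (ContinuousLinearMap.proj j : (Fin n → ℝ) →L[ℝ] ℝ).intervalIntegral_comp_comm
    ((Control.intervalIntegrable_smul_linearFlow A e u).mono_set
      (uIcc_subset_uIcc_left (by rwa [uIcc_of_le zero_le_one])))
  refine h5.trans (Eq.trans ?_ h6)
  refine intervalIntegral.integral_congr fun τ hτ ↦ ?_
  rw [uIcc_of_le ht.1] at hτ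
  simp [hx τ ⟨hτ.1, hτ.2.trans ht.2⟩]

theorem endpointMap_eq_secondKind (hι : ∀ y y', ⁅ι y, ι y'⁆ = 0)
    (hA : ∀ y, ⁅Z, ι y⁆ = ι (A y)) {Ψ : G → (Fin n → ℝ) × ℝ}
    (hΨ : ContMDiff 𝓘(ℝ, E) 𝓘(ℝ, (Fin n → ℝ) × ℝ) ∞ Ψ)
    (hl : Function.LeftInverse Ψ (secondKind ι Z)) (hr : Function.RightInverse Ψ (secondKind ι Z))
    (e : Fin n → ℝ) (u : Control 2) :
    endpointMap ![Z, ι e] u = secondKind ι Z (controlPath A e u 1) := by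
  have h : ∃ γ : ℝ → G, IsHorizontalCurve ![Z, ι e] u γ :=
    ⟨_, isHorizontalCurve_secondKind_controlPath hι hA e u⟩
  rw [endpointMap, dif_pos h, ← h.choose_spec.eq_controlPath hι hA hΨ hl hr ⟨zero_le_one, le_rfl⟩,
    hr]

end Horizontal

/-! ### The differential of the endpoint map -/

section Endpoint

open Filter Topology
open scoped Nat

/-- The product rule for `u ↦ B (u, X(u)^j)`, with `X` linear and `B` bilinear. -/
theorem exists_hasFDerivAt_bilinear_pow {U R : Type*} [NormedAddCommGroup U] [NormedSpace ℝ U]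
    [NormedCommRing R] [NormedAlgebra ℝ R] (B : U →L[ℝ] R →L[ℝ] ℝ) (X : U →L[ℝ] R) (u : U)
    (j : ℕ) :
    ∃ S : U →L[ℝ] ℝ, HasFDerivAt (fun u ↦ B u (X u ^ j)) S u ∧
      ∀ v, S v = B v (X u ^ j) + B u (j • (X u ^ (j - 1) * X v)) := by
  have h1 : HasFDerivAt (fun u ↦ X u ^ j) ((j • X u ^ (j - 1)) • X) u := X.hasFDerivAt.pow j
  refine ⟨_, B.hasFDerivAt_of_bilinear (hasFDerivAt_id u) h1, fun v ↦ ?_⟩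
  simp [add_comm, mul_assoc]

theorem Control.intervalIntegrable_apply_mul (u : Control 2) (i : Fin 2) {g : ℝ → ℝ}
    (hg : Continuous g) {t : ℝ} (ht : t ∈ Icc (0 : ℝ) 1) :
    IntervalIntegrable (fun τ ↦ u τ i * g τ) volume 0 t :=
  (((Control.intervalIntegrable_apply u i).mul_continuousOn hg.continuousOn).mono_set
    (uIcc_subset_uIcc_left (by rwa [uIcc_of_le zero_le_one])))

theorem Control.integral_add_apply_mul (u v : Control 2) (i : Fin 2) {g : ℝ → ℝ}
    (hg : Continuous g) {t : ℝ} (ht : t ∈ Icc (0 : ℝ) 1) :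
    ∫ τ in 0..t, (u + v) τ i * g τ = (∫ τ in 0..t, u τ i * g τ) + ∫ τ in 0..t, v τ i * g τ := by
  rw [← intervalIntegral.integral_add (u.intervalIntegrable_apply_mul i hg ht)
    (v.intervalIntegrable_apply_mul i hg ht)]
  refine intervalIntegral.integral_congr_ae ?_
  have h := Lp.coeFn_add u v
  rw [EventuallyEq, ae_restrict_iff' measurableSet_Icc] at h
  filter_upwards [h] with τ hτ hτ'
  rw [uIoc_of_le ht.1] at hτ'
  rw [hτ ⟨hτ'.1.le, hτ'.2.trans ht.2⟩]
  simp [add_mul]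

theorem Control.integral_smul_apply_mul (c : ℝ) (u : Control 2) (i : Fin 2) (g : ℝ → ℝ)
    {t : ℝ} (ht : t ∈ Icc (0 : ℝ) 1) :
    ∫ τ in 0..t, (c • u) τ i * g τ = c * ∫ τ in 0..t, u τ i * g τ := by
  rw [← intervalIntegral.integral_const_mul]
  refine intervalIntegral.integral_congr_ae ?_
  have h := Lp.coeFn_smul c u
  rw [EventuallyEq, ae_restrict_iff' measurableSet_Icc] at h
  filter_upwards [h] with τ hτ hτ'
  rw [uIoc_of_le ht.1] at hτ'
  rw [hτ ⟨hτ'.1.le, hτ'.2.trans ht.2⟩]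
  simp [mul_assoc]

theorem Control.norm_integral_apply_mul_le (u : Control 2) (i : Fin 2) {g : ℝ → ℝ} {C : ℝ}
    (hC : ∀ t, ‖g t‖ ≤ C) {t : ℝ} (ht : t ∈ Icc (0 : ℝ) 1) :
    ‖∫ τ in 0..t, u τ i * g τ‖ ≤ ‖u‖ * C := by
  have hu : Integrable u (volume.restrict (Icc (0 : ℝ) 1)) := L1.integrable_coeFn u
  have hC0 : 0 ≤ C := (norm_nonneg _).trans (hC 0)
  have hint : IntegrableOn (fun τ ↦ ‖u τ‖ * C) (Icc 0 1) := hu.norm.mul_const C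
  rw [L1.norm_eq_integral_norm, ← integral_mul_const, intervalIntegral.integral_of_le ht.1]
  have hsub : Ioc 0 t ⊆ Icc (0 : ℝ) 1 := fun τ hτ ↦ ⟨hτ.1.le, hτ.2.trans ht.2⟩
  refine (norm_integral_le_of_norm_le (hint.mono_set hsub) (Eventually.of_forall fun τ ↦ ?_)).trans
    (setIntegral_mono_set hint (Eventually.of_forall fun τ ↦ ?_) hsub.eventuallyLE)
  · rw [norm_mul]
    exact mul_le_mul (PiLp.norm_apply_le _ _) (hC τ) (norm_nonneg _) (norm_nonneg _)
  · exact mul_nonneg (norm_nonneg _) hC0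

/-- The primitive `t ↦ ∫₀ᵗ u₁` of the first component, as a continuous linear map from controls to
continuous functions. -/
def controlPrimitive : Control 2 →L[ℝ] C(Icc (0 : ℝ) 1, ℝ) :=
  LinearMap.mkContinuous
    { toFun := fun u ↦ ⟨fun t ↦ ∫ τ in 0..t, u τ 0, by
        have h := (Control.absolutelyContinuousOnInterval_integral u 0).continuousOn
        rw [uIcc_of_le zero_le_one] at h
        exact h.domRestrict⟩
      map_add' := fun u v ↦ by
        ext t
        simpa using! u.integral_add_apply_mul v 0 (continuous_const (y := (1 : ℝ))) t.2
      map_smul' := fun c u ↦ by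
        ext t
        simpa using! u.integral_smul_apply_mul c 0 (fun _ ↦ 1) t.2 }
    1 fun u ↦ by
      rw [ContinuousMap.norm_le _ (by positivity)]
      intro t
      simpa using! u.norm_integral_apply_mul_le 0 (g := fun _ ↦ 1) (C := 1) (by simp) t.2

theorem controlPrimitive_apply (u : Control 2) (t : Icc (0 : ℝ) 1) :
    controlPrimitive u t = ∫ τ in 0..t, u τ 0 := rfl

/-- The pairing `(u, g) ↦ ∫₀¹ u₂ g` of a control with a continuous function. -/
def controlPairing : Control 2 →L[ℝ] C(Icc (0 : ℝ) 1, ℝ) →L[ℝ] ℝ :=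
  LinearMap.mkContinuous₂
    (LinearMap.mk₂ ℝ (fun u g ↦ ∫ τ in 0..1, u τ 1 * IccExtend zero_le_one g τ)
      (fun u v g ↦ u.integral_add_apply_mul v 1 g.continuous.Icc_extend' ⟨zero_le_one, le_rfl⟩)
      (fun c u g ↦ u.integral_smul_apply_mul c 1 _ ⟨zero_le_one, le_rfl⟩)
      (fun u g g' ↦ by
        rw [← intervalIntegral.integral_add
          (u.intervalIntegrable_apply_mul 1 g.continuous.Icc_extend' ⟨zero_le_one, le_rfl⟩)
          (u.intervalIntegrable_apply_mul 1 g'.continuous.Icc_extend' ⟨zero_le_one, le_rfl⟩)]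
        simp [IccExtend, mul_add])
      (fun c u g ↦ by
        rw [smul_eq_mul, ← intervalIntegral.integral_const_mul]
        simp [IccExtend, mul_left_comm]))
    1 fun u g ↦ by
      rw [one_mul]
      exact u.norm_integral_apply_mul_le 1 (fun t ↦ g.norm_coe_le_norm _) ⟨zero_le_one, le_rfl⟩

theorem controlPairing_apply (u : Control 2) (g : C(Icc (0 : ℝ) 1, ℝ)) :
    controlPairing u g = ∫ τ in 0..1, u τ 1 * IccExtend zero_le_one g τ := rfl

/-- The control with given continuous components. -/
def Control.ofContinuous (f g : C(Icc (0 : ℝ) 1, ℝ)) : Control 2 :=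
  Integrable.toL1 (fun t ↦ !₂[IccExtend zero_le_one f t, IccExtend zero_le_one g t]) (by
    have h : Continuous fun t ↦ !₂[IccExtend zero_le_one f t, IccExtend zero_le_one g t] := by
      refine (PiLp.continuous_toLp 2 _).comp (continuous_pi fun i ↦ ?_)
      fin_cases i
      · exact f.continuous.Icc_extend'
      · exact g.continuous.Icc_extend'
    exact h.continuousOn.integrableOn_Icc)

theorem Control.ofContinuous_ae (f g : C(Icc (0 : ℝ) 1, ℝ)) : ∀ᵐ t, t ∈ Icc (0 : ℝ) 1 →
    Control.ofContinuous f g t = !₂[IccExtend zero_le_one f t, IccExtend zero_le_one g t] := by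
  rw [← ae_restrict_iff' measurableSet_Icc]
  exact Integrable.coeFn_toL1 _

theorem controlPrimitive_ofContinuous (f g : C(Icc (0 : ℝ) 1, ℝ)) (t : Icc (0 : ℝ) 1) :
    controlPrimitive (Control.ofContinuous f g) t = ∫ τ in 0..t, IccExtend zero_le_one f τ := by
  rw [controlPrimitive_apply]
  refine intervalIntegral.integral_congr_ae ?_
  filter_upwards [Control.ofContinuous_ae f g] with τ hτ hτ'
  rw [uIoc_of_le t.2.1] at hτ'
  simp [hτ ⟨hτ'.1.le, hτ'.2.trans t.2.2⟩]

theorem controlPairing_ofContinuous (f g h : C(Icc (0 : ℝ) 1, ℝ)) :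
    controlPairing (Control.ofContinuous f g) h =
      ∫ τ in 0..1, IccExtend zero_le_one g τ * IccExtend zero_le_one h τ := by
  rw [controlPairing_apply]
  refine intervalIntegral.integral_congr_ae ?_
  filter_upwards [Control.ofContinuous_ae f g] with τ hτ hτ'
  rw [uIoc_of_le zero_le_one] at hτ'
  simp [hτ ⟨hτ'.1.le, hτ'.2⟩]

/-- By Lebesgue's differentiation theorem, `u₁` vanishes almost everywhere when its primitive
vanishes. -/
theorem controlPrimitive_eq_zero_iff (u : Control 2) : controlPrimitive u = 0 ↔
    ∀ᵐ t ∂(volume.restrict (Icc (0 : ℝ) 1)), u t 0 = 0 := by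
  rw [ae_restrict_iff' measurableSet_Icc]
  constructor
  · intro h
    have h1 := (u.intervalIntegrable_apply 0).ae_hasDerivAt_integral
    have h2 : ∀ x : ℝ, ∀ᵐ t, t ≠ x := fun x ↦ by simp [ae_iff, measure_singleton]
    filter_upwards [h1, h2 0, h2 1] with t ht h0 h1 ht'
    rw [uIcc_of_le zero_le_one] at ht
    refine (ht ht' 0 ⟨le_rfl, zero_le_one⟩).unique
      ((hasDerivAt_const t (0 : ℝ)).congr_of_eventuallyEq ?_)
    filter_upwards [Icc_mem_nhds (lt_of_le_of_ne ht'.1 h0.symm) (lt_of_le_of_ne ht'.2 h1)] with τ hτ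
    exact DFunLike.congr_fun h ⟨τ, hτ⟩
  · intro h
    ext t
    rw [controlPrimitive_apply, ContinuousMap.zero_apply]
    refine intervalIntegral.integral_zero_ae ?_
    filter_upwards [h] with τ hτ hτ'
    rw [uIoc_of_le t.2.1] at hτ'
    exact hτ ⟨hτ'.1.le, hτ'.2.trans t.2.2⟩

variable (n : ℕ)

/-- The endpoint map in the coordinates of the second kind, for a type I filiform group: with `x`
the primitive of `u₁`, it is `u ↦ (∫₀¹ u₂ x^j / j!, x(1))`. -/
def modelEndpoint (u : Control 2) : (Fin n → ℝ) × ℝ :=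
  (fun j ↦ controlPairing u (controlPrimitive u ^ (j : ℕ)) / (j : ℕ)!,
    controlPrimitive u ⟨1, zero_le_one, le_rfl⟩)

theorem exists_hasFDerivAt_modelEndpoint (u : Control 2) :
    ∃ S : Control 2 →L[ℝ] (Fin n → ℝ) × ℝ, HasFDerivAt (modelEndpoint n) S u ∧
      ∀ v, S v = (fun j : Fin n ↦ (controlPairing v (controlPrimitive u ^ (j : ℕ)) +
        controlPairing u ((j : ℕ) • (controlPrimitive u ^ ((j : ℕ) - 1) * controlPrimitive v))) /
          (j : ℕ)!, controlPrimitive v ⟨1, zero_le_one, le_rfl⟩) := by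
  choose S hS hSv using exists_hasFDerivAt_bilinear_pow controlPairing controlPrimitive u
  let T : Control 2 →L[ℝ] ℝ :=
    (ContinuousMap.evalCLM ℝ (⟨1, zero_le_one, le_rfl⟩ : Icc (0 : ℝ) 1)).comp controlPrimitive
  refine ⟨(ContinuousLinearMap.pi fun j : Fin n ↦ (((j : ℕ)! : ℕ) : ℝ)⁻¹ • S j).prod T, ?_,
    fun v ↦ ?_⟩
  · refine HasFDerivAt.prodMk (hasFDerivAt_pi.2 fun j ↦ ?_) T.hasFDerivAt
    simp only [div_eq_mul_inv]
    exact (hS j).mul_const _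
  · refine Prod.ext (funext fun j ↦ ?_) rfl
    simp [hSv, div_eq_inv_mul]

/-- If `u₁ = 0`, then the coordinate with index `2` of the endpoint is critical at `u`, because it
is quadratic in `u₁`; otherwise a functional vanishing on the image of the differential gives a
polynomial that vanishes on the range of the nonconstant primitive of `u₁`. -/
theorem surjective_fderiv_modelEndpoint_iff (hn : 3 ≤ n) (u : Control 2) :
    Function.Surjective (fderiv ℝ (modelEndpoint n) u) ↔ controlPrimitive u ≠ 0 := by
  obtain ⟨S, hS, hSv⟩ := exists_hasFDerivAt_modelEndpoint n u
  rw [hS.fderiv]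
  constructor
  · intro h hu
    obtain ⟨v, hv⟩ := h (Pi.single ⟨2, hn⟩ 1, 0)
    have h1 := congrFun (congrArg Prod.fst hv) ⟨2, hn⟩
    rw [hSv] at h1
    simp [hu] at h1
  · intro hu
    by_contra hns
    have hlt : S.range < ⊤ := lt_top_iff_ne_top.2 fun h ↦ hns (LinearMap.range_eq_top.1 h)
    obtain ⟨ℓ, hℓ0, hℓ⟩ := Submodule.exists_le_ker_of_lt_top _ hlt
    have hℓS : ∀ v, ℓ (S v) = 0 := fun v ↦ hℓ ⟨v, rfl⟩
    have hx0 : controlPrimitive u ⟨0, le_rfl, zero_le_one⟩ = 0 := by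
      simp [controlPrimitive_apply]
    set x := controlPrimitive u with hx
    obtain ⟨t₁, ht₁⟩ : ∃ t, x t ≠ 0 := by
      by_contra! h
      exact hu (ContinuousMap.ext h)
    -- the range of `x` contains a nondegenerate interval
    have hinf : (range x).Infinite := by
      have h1 : (range x).OrdConnected :=
        (isPreconnected_range x.continuous).ordConnected
      have h2 := h1.uIcc_subset (mem_range_self ⟨0, le_rfl, zero_le_one⟩) (mem_range_self t₁)
      rw [hx0] at h2
      exact Set.Infinite.mono h2 (Set.Icc_infinite (by simpa using ht₁))
    -- `ℓ ∘ S` vanishes on variations with `v₁ = 0`, so `p(x)` is orthogonal to every continuous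
    -- `v₂`, hence to itself
    let p : Polynomial ℝ := ∑ j : Fin n,
      Polynomial.C (ℓ (Pi.single j 1, 0) / (j : ℕ)!) * Polynomial.X ^ (j : ℕ)
    have hdecomp : ∀ y a, ℓ (y, a) = ∑ j, y j * ℓ (Pi.single j 1, 0) + a * ℓ (0, 1) := by
      intro y a
      have h1 : ((y, a) : (Fin n → ℝ) × ℝ) =
          LinearMap.inl ℝ (Fin n → ℝ) ℝ (∑ j, y j • Pi.single j 1) + a • (0, 1) := by
        rw [← pi_eq_sum_univ' y]
        simp
      rw [h1, map_add, map_smul, map_sum, map_sum]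
      simp only [map_smul, smul_eq_mul]
      rfl
    have hp : ∀ t, p.eval (x t) = 0 := by
      let q : C(Icc (0 : ℝ) 1, ℝ) := Polynomial.aeval x p
      have hq : ∀ t, q t = p.eval (x t) := fun t ↦ by
        simp [q, Polynomial.aeval_continuousMap_apply]
      have hqw : ∀ w, controlPairing w q =
          ∑ j : Fin n, ℓ (Pi.single j 1, 0) / (j : ℕ)! * controlPairing w (x ^ (j : ℕ)) := by
        intro w
        simp only [q, p, map_sum, map_mul, Polynomial.aeval_C, map_pow, Polynomial.aeval_X,
          Algebra.algebraMap_eq_smul_one, smul_mul_assoc, one_mul, map_smul, smul_eq_mul]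
      have h1 := hℓS (Control.ofContinuous 0 q)
      have h2 : controlPrimitive (Control.ofContinuous 0 q) = 0 := by
        ext t
        rw [controlPrimitive_ofContinuous]
        simp [IccExtend]
      rw [hSv, h2, hdecomp] at h1
      have h3 : controlPairing (Control.ofContinuous 0 q) q = 0 := by
        refine (hqw _).trans (Eq.trans ?_ h1)
        simp only [mul_zero, smul_zero, map_zero, add_zero, ContinuousMap.zero_apply, zero_mul]
        exact Finset.sum_congr rfl fun j _ ↦ by ring
      rw [controlPairing_ofContinuous] at h3
      intro t
      by_contra ht
      rw [← hq] at ht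
      refine (intervalIntegral.integral_pos zero_lt_one ?_ (fun τ _ ↦ mul_self_nonneg _)
        ⟨t, t.2, ?_⟩).ne' h3
      · exact (q.continuous.Icc_extend'.mul q.continuous.Icc_extend').continuousOn
      · simpa using mul_self_pos.2 ht
    have hp0 : p = 0 := Polynomial.eq_zero_of_infinite_isRoot p
      (hinf.mono (by rintro _ ⟨t, rfl⟩; exact hp t))
    have hc : ∀ j : Fin n, ℓ (Pi.single j 1, 0) = 0 := by
      intro j
      have h1 := congrArg (fun p : Polynomial ℝ ↦ p.coeff j) hp0
      simp only [p, Polynomial.finsetSum_coeff, Polynomial.coeff_C_mul_X_pow, Fin.val_inj,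
        Finset.sum_ite_eq, Finset.mem_univ, if_true, Polynomial.coeff_zero] at h1
      exact (div_eq_zero_iff.1 h1).resolve_right (by positivity)
    have hμ : ℓ (0, 1) = 0 := by
      have h1 := hℓS (Control.ofContinuous 1 0)
      rw [hSv, hdecomp] at h1
      simp only [hc, controlPrimitive_ofContinuous] at h1
      simpa [IccExtend] using h1
    refine hℓ0 (LinearMap.ext fun z ↦ ?_)
    rw [← Prod.mk.eta (p := z), hdecomp]
    simp [hc, hμ]

end Endpoint

/-! ### The shift -/

section Shift

open scoped Nat

/-- The nilpotent shift `e_j ↦ e_{j+1}` of `ℝⁿ`. -/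
def shift (n : ℕ) : (Fin n → ℝ) →L[ℝ] (Fin n → ℝ) :=
  LinearMap.toContinuousLinearMap
    { toFun := fun y j ↦ if (j : ℕ) = 0 then 0 else y ⟨j - 1, (Nat.sub_le _ _).trans_lt j.2⟩
      map_add' := fun y y' ↦ by
        ext j
        by_cases h : (j : ℕ) = 0 <;> simp [h]
      map_smul' := fun c y ↦ by
        ext j
        by_cases h : (j : ℕ) = 0 <;> simp [h] }

theorem shift_apply {n : ℕ} (y : Fin n → ℝ) (j : Fin n) :
    shift n y j = if (j : ℕ) = 0 then 0 else y ⟨j - 1, (Nat.sub_le _ _).trans_lt j.2⟩ := rfl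

/-- The first column of the exponential of the shift: by induction on `j`, since the coordinate with
index `j + 1` is a primitive of the coordinate with index `j`. -/
theorem linearFlow_shift_single {n : ℕ} (hn : 0 < n) (x : ℝ) (j : Fin n) :
    linearFlow (shift n) x (Pi.single ⟨0, hn⟩ 1) j = x ^ (j : ℕ) / (j : ℕ)! := by
  obtain ⟨j, hj⟩ := j
  induction j generalizing x with
  | zero =>
    have h1 : ∀ t, HasDerivAt (fun t ↦ linearFlow (shift n) t (Pi.single ⟨0, hn⟩ 1) ⟨0, hj⟩) 0 t :=
      fun t ↦ by
        simpa [shift_apply] using! hasDerivAt_pi.1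
          (hasDerivAt_linearFlow (shift n) (Pi.single ⟨0, hn⟩ 1) t) ⟨0, hj⟩
    have h2 := is_const_of_deriv_eq_zero (fun t ↦ (h1 t).differentiableAt)
      (fun t ↦ (h1 t).deriv) x 0
    simpa [linearFlow_zero_apply] using h2
  | succ j ih =>
    have h1 : ∀ t, HasDerivAt (fun t ↦ linearFlow (shift n) t (Pi.single ⟨0, hn⟩ 1) ⟨j + 1, hj⟩ -
        t ^ (j + 1) / (j + 1)!) 0 t := fun t ↦ by
      have h2 := (hasDerivAt_pi.1 (hasDerivAt_linearFlow (shift n) (Pi.single ⟨0, hn⟩ 1) t)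
        ⟨j + 1, hj⟩).sub ((hasDerivAt_pow (j + 1) t).div_const ((j + 1)! : ℝ))
      refine h2.congr_deriv ?_
      rw [shift_apply]
      simp only [Nat.add_eq_zero_iff, one_ne_zero, and_false, if_false, Nat.add_sub_cancel]
      rw [ih t ((Nat.lt_succ_self j).trans hj), Nat.factorial_succ]
      push_cast
      field_simp
      ring
    have h2 := is_const_of_deriv_eq_zero (fun t ↦ (h1 t).differentiableAt)
      (fun t ↦ (h1 t).deriv) x 0
    simpa [linearFlow_zero_apply, sub_eq_zero] using h2

theorem controlPath_shift_one {n : ℕ} (hn : 0 < n) (u : Control 2) :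
    controlPath (shift n) (Pi.single ⟨0, hn⟩ 1) u 1 = modelEndpoint n u := by
  refine Prod.ext (funext fun j ↦ ?_) rfl
  have h1 := (ContinuousLinearMap.proj j : (Fin n → ℝ) →L[ℝ] ℝ).intervalIntegral_comp_comm
    (Control.intervalIntegrable_smul_linearFlow (shift n) (Pi.single ⟨0, hn⟩ 1) u)
  refine h1.symm.trans ?_
  change _ = controlPairing u (controlPrimitive u ^ (j : ℕ)) / (j : ℕ)!
  rw [controlPairing_apply, ← intervalIntegral.integral_div]
  refine intervalIntegral.integral_congr fun τ hτ ↦ ?_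
  rw [uIcc_of_le zero_le_one] at hτ
  simp [linearFlow_shift_single, IccExtend_of_mem _ _ hτ, controlPrimitive_apply, mul_div_assoc]

theorem controlPath_of_ae_eq_zero {n : ℕ} (A : (Fin n → ℝ) →L[ℝ] (Fin n → ℝ)) (e : Fin n → ℝ)
    {u : Control 2} (hu : ∀ᵐ t ∂(volume.restrict (Icc (0 : ℝ) 1)), u t 0 = 0) {t : ℝ}
    (ht : t ∈ Icc (0 : ℝ) 1) : controlPath A e u t = ((∫ τ in 0..t, u τ 1) • e, 0) := by
  have h1 := (controlPrimitive_eq_zero_iff u).2 hu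
  have h2 : ∀ t ∈ Icc (0 : ℝ) 1, ∫ τ in 0..t, u τ 0 = 0 := fun t ht ↦
    DFunLike.congr_fun h1 ⟨t, ht⟩
  refine Prod.ext ?_ (h2 t ht)
  change _ = (∫ τ in 0..t, u τ 1) • e
  rw [← intervalIntegral.integral_smul_const]
  refine intervalIntegral.integral_congr fun τ hτ ↦ ?_
  rw [uIcc_of_le ht.1] at hτ
  simp [h2 τ ⟨hτ.1, hτ.2.trans ht.2⟩, linearFlow_zero_apply]

end Shift

/-! ### Singular controls, abnormal curves and the abnormal set -/

section Abnormal

open Filter Topology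

variable {E : Type*} [NormedAddCommGroup E] [NormedSpace ℝ E]
  {G : Type*} [TopologicalSpace G] [ChartedSpace E G] [Group G] [LieGroup 𝓘(ℝ, E) ∞ G]
  {n : ℕ} [CompleteSpace E] [T2Space G]
  {ι : (Fin n → ℝ) →ₗ[ℝ] GroupLieAlgebra 𝓘(ℝ, E) G} {Z : GroupLieAlgebra 𝓘(ℝ, E) G}
  {Ψ : G → (Fin n → ℝ) × ℝ}

theorem endpointMap_eq_comp_modelEndpoint (hn : 0 < n) (hι : ∀ y y', ⁅ι y, ι y'⁆ = 0)
    (hA : ∀ y, ⁅Z, ι y⁆ = ι (shift n y))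
    (hΨ : ContMDiff 𝓘(ℝ, E) 𝓘(ℝ, (Fin n → ℝ) × ℝ) ∞ Ψ)
    (hl : Function.LeftInverse Ψ (secondKind ι Z))
    (hr : Function.RightInverse Ψ (secondKind ι Z)) :
    endpointMap ![Z, ι (Pi.single ⟨0, hn⟩ 1)] = secondKind ι Z ∘ modelEndpoint n := by
  funext u
  rw [endpointMap_eq_secondKind hι hA hΨ hl hr, controlPath_shift_one, Function.comp_apply]

theorem mdifferentiable_secondKind_comp_modelEndpoint (hι : ∀ y y', ⁅ι y, ι y'⁆ = 0) :
    MDifferentiable 𝓘(ℝ, Control 2) 𝓘(ℝ, E) (secondKind ι Z ∘ modelEndpoint n) := by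
  refine ((contMDiff_secondKind hι).mdifferentiable (by simp)).comp fun u ↦ ?_
  obtain ⟨S, hS, -⟩ := exists_hasFDerivAt_modelEndpoint n u
  exact hS.differentiableAt.mdifferentiableAt

theorem isSingularControl_iff (hn : 3 ≤ n) (hι : ∀ y y', ⁅ι y, ι y'⁆ = 0)
    (hA : ∀ y, ⁅Z, ι y⁆ = ι (shift n y))
    (hb : Function.Bijective fun p : (Fin n → ℝ) × ℝ ↦ ι p.1 + p.2 • Z)
    (hΨ : ContMDiff 𝓘(ℝ, E) 𝓘(ℝ, (Fin n → ℝ) × ℝ) ∞ Ψ)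
    (hl : Function.LeftInverse Ψ (secondKind ι Z))
    (hr : Function.RightInverse Ψ (secondKind ι Z)) (u : Control 2) :
    IsSingularControl ![Z, ι (Pi.single ⟨0, (Nat.zero_lt_succ 2).trans_le hn⟩ 1)] u ↔
      ∀ᵐ t ∂(volume.restrict (Icc (0 : ℝ) 1)), u t 0 = 0 := by
  rw [IsSingularControl, endpointMap_eq_comp_modelEndpoint _ hι hA hΨ hl hr,
    ← controlPrimitive_eq_zero_iff, not_iff_comm, ← ne_eq,
    ← surjective_fderiv_modelEndpoint_iff n hn]
  obtain ⟨L, hL⟩ := exists_equiv_mfderiv_secondKind hι hA hb (modelEndpoint n u)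
  obtain ⟨S, hS, -⟩ := exists_hasFDerivAt_modelEndpoint n u
  have h1 : (mfderiv 𝓘(ℝ, Control 2) 𝓘(ℝ, E) (secondKind ι Z ∘ modelEndpoint n) u :
      Control 2 →L[ℝ] E) = L.toContinuousLinearMap.comp (fderiv ℝ (modelEndpoint n) u) := by
    rw [← hL, hS.fderiv]
    exact (((contMDiff_secondKind hι).mdifferentiable (by simp) _).hasMFDerivAt.comp u
      hS.hasMFDerivAt).mfderiv
  exact (L.toEquiv.comp_surjective _).symm.trans
    (iff_of_eq (congrArg (fun T : Control 2 →L[ℝ] E ↦ Function.Surjective T) h1.symm))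

theorem secondKind_smul_zero (e : Fin n → ℝ) (τ : ℝ) :
    secondKind ι Z (τ • e, 0) = lieExp (τ • ι e) := by
  simp [secondKind, lieExp_zero]

/-- A curve in the line `exp (τ ι e₀)` is the horizontal curve of the control `(0, f')`, with `f`
the parameter `τ` along the curve. -/
theorem isAbnormalCurve_iff (hn : 3 ≤ n) (hι : ∀ y y', ⁅ι y, ι y'⁆ = 0)
    (hA : ∀ y, ⁅Z, ι y⁆ = ι (shift n y))
    (hb : Function.Bijective fun p : (Fin n → ℝ) × ℝ ↦ ι p.1 + p.2 • Z)
    (hΨ : ContMDiff 𝓘(ℝ, E) 𝓘(ℝ, (Fin n → ℝ) × ℝ) ∞ Ψ)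
    (hl : Function.LeftInverse Ψ (secondKind ι Z))
    (hr : Function.RightInverse Ψ (secondKind ι Z)) (γ : ℝ → G) :
    IsAbnormalCurve ![Z, ι (Pi.single ⟨0, (Nat.zero_lt_succ 2).trans_le hn⟩ 1)] γ ↔
      IsACCurve (E := E) γ ∧ γ 0 = 1 ∧ ∀ t ∈ Icc (0 : ℝ) 1, ∃ τ : ℝ,
        γ t = lieExp (τ • ι (Pi.single ⟨0, (Nat.zero_lt_succ 2).trans_le hn⟩ 1)) := by
  set e : Fin n → ℝ := Pi.single ⟨0, (Nat.zero_lt_succ 2).trans_le hn⟩ 1 with he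
  have : IsManifold 𝓘(ℝ, E) ∞ G := inferInstance
  constructor
  · rintro ⟨u, hu, hγ⟩
    rw [isSingularControl_iff hn hι hA hb hΨ hl hr] at hu
    refine ⟨hγ.1, hγ.2.1, fun t ht ↦ ⟨∫ τ in 0..t, u τ 1, ?_⟩⟩
    rw [← secondKind_smul_zero, ← controlPath_of_ae_eq_zero (shift n) e hu ht,
      ← hγ.eq_controlPath hι hA hΨ hl hr ht, hr]
  · rintro ⟨hAC, h0, h⟩
    let c : (Fin n → ℝ) × ℝ →L[ℝ] ℝ := (ContinuousLinearMap.proj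
      ⟨0, (Nat.zero_lt_succ 2).trans_le hn⟩).comp (ContinuousLinearMap.fst ℝ (Fin n → ℝ) ℝ)
    have hc : ∀ τ : ℝ, c (τ • e, 0) = τ := fun τ ↦ by simp [c, he]
    have hΨγ : ∀ t ∈ Icc (0 : ℝ) 1, Ψ (γ t) = (c (Ψ (γ t)) • e, 0) := by
      intro t ht
      obtain ⟨τ, hτ⟩ := h t ht
      rw [hτ, ← secondKind_smul_zero, hl, hc]
    let f : ℝ → ℝ := fun t ↦ c (Ψ (γ t))
    have hf : IsIntegralOfDeriv f 0 1 := hAC.isIntegralOfDeriv_comp (c.contMDiff.comp hΨ)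
    have hf0 : f 0 = 0 := by
      have h1 : (secondKind ι Z 0 : G) = 1 := by simp [secondKind, lieExp_zero]
      simp [f, h0, ← h1, hl 0]
    have hint : Integrable (fun t ↦ !₂[0, deriv f t]) (volume.restrict (Icc (0 : ℝ) 1)) := by
      have h1 := hf.1
      rw [intervalIntegrable_iff_integrableOn_Icc_of_le zero_le_one] at h1
      have h2 := h1.smul_const (!₂[0, 1] : EuclideanSpace ℝ (Fin 2))
      refine h2.congr (Eventually.of_forall fun t ↦ ?_)
      ext i
      fin_cases i <;> simp
    obtain ⟨u, hu⟩ : ∃ u : Control 2,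
        u =ᵐ[volume.restrict (Icc (0 : ℝ) 1)] fun t ↦ !₂[0, deriv f t] :=
      ⟨hint.toL1, hint.coeFn_toL1⟩
    have hu0 : ∀ᵐ t ∂(volume.restrict (Icc (0 : ℝ) 1)), u t 0 = 0 := by
      filter_upwards [hu] with t ht
      simp [ht]
    have hpath : ∀ t ∈ Icc (0 : ℝ) 1, controlPath (shift n) e u t = Ψ (γ t) := by
      intro t ht
      rw [controlPath_of_ae_eq_zero _ _ hu0 ht, hΨγ t ht]
      congr 2
      have h1 := hf.2 t ht
      rw [hf0, sub_zero] at h1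
      refine Eq.trans ?_ h1
      refine intervalIntegral.integral_congr_ae ?_
      rw [EventuallyEq, ae_restrict_iff' measurableSet_Icc] at hu
      filter_upwards [hu] with τ hτ hτ'
      rw [uIoc_of_le ht.1] at hτ'
      simp [hτ ⟨hτ'.1.le, hτ'.2.trans ht.2⟩]
    refine ⟨u, (isSingularControl_iff hn hι hA hb hΨ hl hr u).2 hu0, hAC, h0, ?_⟩
    have heq : ∀ t ∈ Icc (0 : ℝ) 1, γ t = secondKind ι Z (controlPath (shift n) e u t) :=
      fun t ht ↦ by rw [hpath t ht, hr]
    have hH := (isHorizontalCurve_secondKind_controlPath hι hA e u).2.2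
    have h2 : ∀ x : ℝ, ∀ᵐ t, t ≠ x := fun x ↦ by simp [ae_iff, measure_singleton]
    rw [ae_restrict_iff' measurableSet_Icc] at hH ⊢
    filter_upwards [hH, h2 0, h2 1] with t ht h0 h1 ht'
    have h3 : γ =ᶠ[𝓝 t] fun t ↦ secondKind ι Z (controlPath (shift n) e u t) := by
      filter_upwards [Icc_mem_nhds (lt_of_le_of_ne ht'.1 h0.symm) (lt_of_le_of_ne ht'.2 h1)]
        with τ hτ using heq τ hτ
    have h4 := (ht ht').congr_of_eventuallyEq h3
    -- the velocity in `h4` is based at the point of the other curve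
    have key : ∀ g : G, γ t = g → HasMFDerivAt 𝓘(ℝ, ℝ) 𝓘(ℝ, E) γ t
        ((1 : ℝ →L[ℝ] ℝ).smulRight
          (mulInvariantVectorField (∑ i, u t i • ![Z, ι e] i) g : E)) →
        HasMFDerivAt 𝓘(ℝ, ℝ) 𝓘(ℝ, E) γ t
        ((1 : ℝ →L[ℝ] ℝ).smulRight
          (mulInvariantVectorField (∑ i, u t i • ![Z, ι e] i) (γ t) : E)) := by
      rintro _ rfl h
      exact h
    exact key _ (heq t ht') h4

theorem abnormalSet_eq_range (hn : 3 ≤ n) (hι : ∀ y y', ⁅ι y, ι y'⁆ = 0)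
    (hA : ∀ y, ⁅Z, ι y⁆ = ι (shift n y))
    (hb : Function.Bijective fun p : (Fin n → ℝ) × ℝ ↦ ι p.1 + p.2 • Z)
    (hΨ : ContMDiff 𝓘(ℝ, E) 𝓘(ℝ, (Fin n → ℝ) × ℝ) ∞ Ψ)
    (hl : Function.LeftInverse Ψ (secondKind ι Z))
    (hr : Function.RightInverse Ψ (secondKind ι Z)) :
    abnormalSet ![Z, ι (Pi.single ⟨0, (Nat.zero_lt_succ 2).trans_le hn⟩ 1)] =
      range fun τ : ℝ ↦
        (lieExp (τ • ι (Pi.single ⟨0, (Nat.zero_lt_succ 2).trans_le hn⟩ 1)) : G) := by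
  set e : Fin n → ℝ := Pi.single ⟨0, (Nat.zero_lt_succ 2).trans_le hn⟩ 1 with he
  have hend : ∀ u : Control 2, (∀ᵐ t ∂(volume.restrict (Icc (0 : ℝ) 1)), u t 0 = 0) →
      endpointMap ![Z, ι e] u = lieExp ((∫ τ in 0..1, u τ 1) • ι e) := by
    intro u hu
    rw [endpointMap_eq_secondKind hι hA hΨ hl hr,
      controlPath_of_ae_eq_zero _ _ hu ⟨zero_le_one, le_rfl⟩, secondKind_smul_zero]
  apply Subset.antisymm
  · rintro g ⟨u, hu, rfl⟩
    rw [isSingularControl_iff hn hι hA hb hΨ hl hr] at hu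
    exact ⟨_, (hend u hu).symm⟩
  · rintro _ ⟨τ, rfl⟩
    let u := Control.ofContinuous 0 (ContinuousMap.const _ τ)
    have hu : ∀ᵐ t ∂(volume.restrict (Icc (0 : ℝ) 1)), u t 0 = 0 := by
      rw [← controlPrimitive_eq_zero_iff]
      ext t
      rw [controlPrimitive_ofContinuous]
      simp [IccExtend]
    refine ⟨u, (isSingularControl_iff hn hι hA hb hΨ hl hr u).2 hu, ?_⟩
    rw [hend u hu]
    congr 2
    have h1 : controlPairing u 1 = τ := by
      rw [controlPairing_ofContinuous]
      simp [IccExtend]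
    rw [← h1, controlPairing_apply]
    simp [IccExtend]

/-- In the coordinates of the second kind, `τ ↦ exp (τ ι e₀)` is the first coordinate axis. -/
theorem isSubmanifoldOfCodim_range_lieExp (hn : 0 < n) (hι : ∀ y y', ⁅ι y, ι y'⁆ = 0)
    (hA : ∀ y, ⁅Z, ι y⁆ = ι (shift n y))
    (hΨ : ContMDiff 𝓘(ℝ, E) 𝓘(ℝ, (Fin n → ℝ) × ℝ) ∞ Ψ)
    (hl : Function.LeftInverse Ψ (secondKind ι Z))
    (hr : Function.RightInverse Ψ (secondKind ι Z)) :
    IsSubmanifoldOfCodim (E := E)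
      (range fun τ : ℝ ↦ (lieExp (τ • ι (Pi.single ⟨0, hn⟩ 1)) : G)) n := by
  -- the line is cut out by all coordinates of the second kind but the first coordinate of `y`,
  -- whose place in `ℝⁿ` is taken by `x`
  let l : (Fin n → ℝ) × ℝ →L[ℝ] (Fin n → ℝ) := ContinuousLinearMap.pi fun i ↦
    if i = ⟨0, hn⟩ then ContinuousLinearMap.snd ℝ (Fin n → ℝ) ℝ
    else (ContinuousLinearMap.proj i).comp (ContinuousLinearMap.fst ℝ (Fin n → ℝ) ℝ)
  have hl_apply : ∀ p i, l p i = if i = ⟨0, hn⟩ then p.2 else p.1 i := by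
    intro p i
    by_cases h : i = ⟨0, hn⟩ <;> simp [l, h]
  have hlsurj : Function.Surjective l := by
    intro w
    refine ⟨(w, w ⟨0, hn⟩), funext fun i ↦ ?_⟩
    rw [hl_apply]
    split_ifs with h
    · rw [h]
    · rfl
  let L : (Fin n → ℝ) × ℝ →L[ℝ] EuclideanSpace ℝ (Fin n) :=
    (EuclideanSpace.equiv (Fin n) ℝ).symm.toContinuousLinearMap.comp l
  have hLsurj : Function.Surjective L :=
    (EuclideanSpace.equiv (Fin n) ℝ).symm.surjective.comp hlsurj
  have hL0 : ∀ p, L p = 0 ↔ ∃ τ : ℝ, p = (τ • Pi.single ⟨0, hn⟩ 1, 0) := by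
    intro p
    have h1 : L p = 0 ↔ l p = 0 := (EuclideanSpace.equiv (Fin n) ℝ).symm.map_eq_zero_iff
    rw [h1]
    constructor
    · intro h
      refine ⟨p.1 ⟨0, hn⟩, Prod.ext (funext fun i ↦ ?_) ?_⟩
      · have h2 := congrFun h i
        rw [hl_apply] at h2
        by_cases hi : i = ⟨0, hn⟩
        · simp [hi]
        · simpa [hi] using h2
      · simpa [hl_apply] using congrFun h ⟨0, hn⟩
    · rintro ⟨τ, rfl⟩
      ext i
      rw [hl_apply]
      split_ifs with h
      · rfl
      · simp [h]
  rintro g -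
  refine ⟨univ, isOpen_univ, mem_univ g, fun q ↦ L (Ψ q), ?_, ?_, ?_⟩
  · exact (L.contMDiff.comp hΨ).contMDiffOn
  · have h1 := (L.hasFDerivAt (x := Ψ g)).hasMFDerivAt.comp g
      ((hΨ.mdifferentiable (by simp)) g).hasMFDerivAt
    have h2 : (mfderiv 𝓘(ℝ, E) 𝓘(ℝ, EuclideanSpace ℝ (Fin n)) (fun q ↦ L (Ψ q)) g :
        E →L[ℝ] EuclideanSpace ℝ (Fin n)) =
        L.comp (mfderiv 𝓘(ℝ, E) 𝓘(ℝ, (Fin n → ℝ) × ℝ) Ψ g : E →L[ℝ] (Fin n → ℝ) × ℝ) := h1.mfderiv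
    intro w
    obtain ⟨⟨y, a⟩, hya⟩ := hLsurj w
    refine ⟨mulInvariantVectorField (ι (linearFlow (shift n) (-(Ψ g).2) y) + a • Z) g, ?_⟩
    refine (DFunLike.congr_fun h2 _).trans (Eq.trans (congrArg L ?_) hya)
    have h3 := mfderiv_inverse_secondKind hι hA hΨ hl (Ψ g)
      (linearFlow (shift n) (-(Ψ g).2) y) a
    rw [hr g, linearFlow_neg_apply] at h3
    exact h3
  · ext q
    simp only [inter_univ, mem_range, mem_univ, true_and, hL0]
    refine exists_congr fun τ ↦ ?_
    rw [← secondKind_smul_zero]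
    exact ⟨fun h ↦ by rw [← h, hl], fun h ↦ by rw [← h, hr]⟩

end Abnormal

/-! ### Type I filiform Lie algebras -/

section Filiform

variable {𝔤 : Type*} [LieRing 𝔤] [LieAlgebra ℝ 𝔤] {s : ℕ} {V : ℕ → Submodule ℝ 𝔤}
  {X : Module.Basis (Fin (s + 1)) ℝ 𝔤}

/-- The linear combinations of the basis vectors other than the first. -/
def tailCombination (X : Module.Basis (Fin (s + 1)) ℝ 𝔤) : (Fin s → ℝ) →ₗ[ℝ] 𝔤 :=
  Fintype.linearCombination ℝ fun j ↦ X j.succ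

theorem tailCombination_apply (y : Fin s → ℝ) : tailCombination X y = ∑ j, y j • X j.succ :=
  rfl

theorem IsTypeIFiliform.bracket_tailCombination (hX : IsTypeIFiliform s V X) (y y' : Fin s → ℝ) :
    ⁅tailCombination X y, tailCombination X y'⁆ = 0 := by
  simp only [tailCombination_apply, sum_lie, lie_sum, smul_lie, lie_smul]
  simp [hX.bracket_eq_zero _ _ (Fin.succ_ne_zero _) (Fin.succ_ne_zero _)]

theorem IsTypeIFiliform.bracket_zero_tailCombination (hX : IsTypeIFiliform s V X)
    (y : Fin s → ℝ) : ⁅X 0, tailCombination X y⁆ = tailCombination X (shift s y) := by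
  obtain _ | m := s
  · simp [tailCombination_apply]
  · have h1 : ∀ j : Fin m, ⁅X 0, X j.castSucc.succ⁆ = X j.succ.succ := fun j ↦
      hX.bracket_succ (j + 1) (Nat.succ_pos _) (Nat.succ_lt_succ j.2)
    have h2 : ⁅X 0, X (Fin.last m).succ⁆ = 0 := hX.bracket_last
    rw [tailCombination_apply, tailCombination_apply, Fin.sum_univ_castSucc, Fin.sum_univ_succ,
      lie_add, lie_sum]
    simp only [lie_smul, h1, h2, smul_zero, add_zero]
    simp only [shift_apply]
    simp
    rfl

theorem bijective_tailCombination_add (X : Module.Basis (Fin (s + 1)) ℝ 𝔤) :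
    Function.Bijective fun p : (Fin s → ℝ) × ℝ ↦ tailCombination X p.1 + p.2 • X 0 := by
  have h1 : (fun p : (Fin s → ℝ) × ℝ ↦ tailCombination X p.1 + p.2 • X 0) =
      X.equivFun.symm ∘ fun p : (Fin s → ℝ) × ℝ ↦ (Fin.cons p.2 p.1 : Fin (s + 1) → ℝ) := by
    funext p
    simp [tailCombination_apply, Fin.sum_univ_succ, Module.Basis.equivFun_symm_apply, add_comm]
  rw [h1]
  refine X.equivFun.symm.bijective.comp ⟨fun p q h ↦ ?_, fun w ↦ ⟨(Fin.tail w, w 0), ?_⟩⟩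
  · exact Prod.ext (Fin.cons_inj.1 h).2 (Fin.cons_inj.1 h).1
  · exact Fin.cons_self_tail w

end Filiform

theorem mainTheorem4 (s : ℕ) (hs : 3 ≤ s)
    (G : Type*) [TopologicalSpace G] [T2Space G] [SimplyConnectedSpace G]
    [ChartedSpace (EuclideanSpace ℝ (Fin (s + 1))) G] [Group G]
    [LieGroup 𝓘(ℝ, EuclideanSpace ℝ (Fin (s + 1))) ∞ G]
    (V : ℕ → Submodule ℝ (GroupLieAlgebra 𝓘(ℝ, EuclideanSpace ℝ (Fin (s + 1))) G))
    (X : Module.Basis (Fin (s + 1)) ℝ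
      (GroupLieAlgebra 𝓘(ℝ, EuclideanSpace ℝ (Fin (s + 1))) G))
    (hX : IsTypeIFiliform s V X) :
    -- each control has exactly one horizontal curve, and the endpoint map is differentiable
    (∀ u : Control 2, ∃ γ : ℝ → G, IsHorizontalCurve ![X 0, X 1] u γ ∧
      ∀ γ' : ℝ → G, IsHorizontalCurve ![X 0, X 1] u γ' → EqOn γ' γ (Icc 0 1)) ∧
    MDifferentiable 𝓘(ℝ, Control 2) 𝓘(ℝ, EuclideanSpace ℝ (Fin (s + 1)))
      (endpointMap ![X 0, X 1]) ∧
    -- the singular controls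
    (∀ u : Control 2, IsSingularControl ![X 0, X 1] u ↔
      ∀ᵐ t ∂(volume.restrict (Icc (0 : ℝ) 1)), u t 0 = 0) ∧
    -- the abnormal curves
    (∀ γ : ℝ → G, IsAbnormalCurve ![X 0, X 1] γ ↔
      IsACCurve (E := EuclideanSpace ℝ (Fin (s + 1))) γ ∧ γ 0 = 1 ∧
        ∀ t ∈ Icc (0 : ℝ) 1, ∃ τ : ℝ, γ t = lieExp (τ • X 1)) ∧
    -- the abnormal set
    abnormalSet ![X 0, X 1] = range (fun τ : ℝ => lieExp (τ • X 1)) ∧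
    IsSubmanifoldOfCodim (E := EuclideanSpace ℝ (Fin (s + 1))) (abnormalSet ![X 0, X 1]) s := by
  have hs0 : 0 < s := (Nat.zero_lt_succ 2).trans_le hs
  have hι := hX.bracket_tailCombination
  have hA := hX.bracket_zero_tailCombination
  have hb := bijective_tailCombination_add X
  obtain ⟨Ψ, hΨ, hl, hr⟩ := exists_contMDiff_inverse_secondKind hι hA hb
  have hX1 : X 1 = tailCombination X (Pi.single ⟨0, hs0⟩ 1) := by
    have h1 : (1 : Fin (s + 1)) = Fin.succ ⟨0, hs0⟩ := by
      obtain _ | m := s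
      · exact absurd hs0 (lt_irrefl 0)
      · rfl
    rw [tailCombination, Fintype.linearCombination_apply_single, one_smul, h1]
  rw [hX1]
  refine ⟨fun u ↦ ⟨_, isHorizontalCurve_secondKind_controlPath hι hA _ u, fun γ' hγ' t ht ↦ ?_⟩,
    ?_, isSingularControl_iff hs hι hA hb hΨ hl hr, isAbnormalCurve_iff hs hι hA hb hΨ hl hr,
    abnormalSet_eq_range hs hι hA hb hΨ hl hr, ?_⟩
  · rw [← hγ'.eq_controlPath hι hA hΨ hl hr ht, hr]
  · rw [endpointMap_eq_comp_modelEndpoint hs0 hι hA hΨ hl hr]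
    exact mdifferentiable_secondKind_comp_modelEndpoint hι
  · rw [abnormalSet_eq_range hs hι hA hb hΨ hl hr]
    exact isSubmanifoldOfCodim_range_lieExp hs0 hι hA hΨ hl hr

end
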